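/- Let $\Phi$ be the root system $B_n$, $C_n$ or $D_n$ with positive roots $\varepsilon_i\pm\varepsilon_j$ ($1\le i<j\le n$) and, in addition, $\varepsilon_i$ ($1\le i\le n$) for $B_n$, respectively $2\varepsilon_i$ ($1\le i\le n$) for $C_n$. Let $k$ be a field of characteristic different from $2$ (characteristic zero is allowed, and if $n\le 1$ then $k$ may be any field). Index the rows and columns of $m\times m$ matrices by $1,\dots,n,0,-n,\dots,-1$, where the index $0$ occurs only for $B_n$ (so $m=2n+1$ for $B_n$ and $m=2n$ for $C_n$, $D_n$), and let $e_{a,b}$ be the matrix units. Let $\mathfrak u\subset\mathfrak{gl}_m(k)$ be the Lie subalgebra spanned by the root vectors $e_\alpha$, $\alpha\in\Phi^+$, where $$e_{\varepsilon_i-\varepsilon_j}=e_{j,i}-e_{-i,-j},\qquad e_{\varepsilon_i+\varepsilon_j}=e_{-j,i}\mp e_{-i,j},\qquad e_{\varepsilon_i}=e_{0,i}-e_{-i,0},\qquad e_{2\varepsilon_i}=e_{-i,i},$$ the sign in $e_{\varepsilon_i+\varepsilon_j}$ being $-$ for $B_n$, $D_n$ and $+$ for $C_n$. The $e_\alpha$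 form a basis of $\mathfrak u$; let $e_\alpha^*$ be the dual basis of $\mathfrak u^*$. Let $D\subset\Phi^+$ be a set of pairwise orthogonal roots such that, if $\Phi=B_n$, at most one of the roots $\varepsilon_i$ is in $D$, and, if $\Phi=C_n$, for no $i<j$ are both $\varepsilon_i-\varepsilon_j$ and $\varepsilon_i+\varepsilon_j$ in $D$. Let $\xi=(\xi_\beta)_{\beta\in D}$ be non-zero scalars from $k$, and let $f=\sum_{\beta\in D}\xi_\beta e_\beta^*\in\mathfrak u^*$ be the canonical form. Put $\operatorname{col}(\varepsilon_i\pm\varepsilon_j)=\operatorname{col}(\varepsilon_i)=\operatorname{col}(2\varepsilon_i)=i$ and $\operatorname{row}(\varepsilon_i\pm\varepsilon_j)=\mp j$, $\operatorname{row}(\varepsilon_i)=0$, $\operatorname{row}(2\varepsilon_i)=-i$. For $\beta\in\Phi^+$ let $S(\beta)=\{\alpha\in\Phi^+:\beta-\alpha\in\Phi^+\}$, let $S^+(\beta)=\{\varepsilon_i+\varepsilon_l: i<l\le n\}$ if $\Phi=C_n$ and $\beta=2\varepsilon_i$, and $S^+(\beta)=\{\alpha\in S(\beta):\operatorname{col}(\alpha)=\operatorname{col}(\beta)\}$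 otherwise, and let $S^-(\beta)=S(\beta)\setminus S^+(\beta)$. Define recursively, for $j=1,\dots,n$, $$\mathcal M_j=\Bigl\{\gamma : \gamma\in S^-(\beta)\text{ for some }\beta\in D\text{ with }\operatorname{col}(\beta)=j\text{ and }\gamma,\ \beta-\gamma\notin\bigcup_{l<j}\mathcal M_l\Bigr\},$$ and put $\mathcal M=\bigcup_j\mathcal M_j$ and $\mathcal P=\Phi^+\setminus\mathcal M$. Let $\mathfrak p_0\subset\mathfrak u$ be the span of all vectors $$\xi_{\varepsilon_i+\varepsilon_j}\,e_{\varepsilon_l-\varepsilon_j}-\xi_{\varepsilon_i-\varepsilon_j}\,e_{\varepsilon_l+\varepsilon_j}$$ with $i<l<j$, $\varepsilon_i-\varepsilon_j,\ \varepsilon_i+\varepsilon_j\in D$, $\varepsilon_l-\varepsilon_j,\ \varepsilon_l+\varepsilon_j\in\mathcal M_i$, and no root of $D$ having row $-l$. Finally put $$\mathfrak p=\mathfrak p_{D,\xi}=\sum_{\alpha\in\mathcal P}k\,e_\alpha+\mathfrak p_0 .$$ **Theorem 1.1.** The subspace $\mathfrak p$ is a polarization of $\mathfrak u$ at $f$;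 that is, $\mathfrak p$ is a Lie subalgebra of $\mathfrak u$, $f([\mathfrak p,\mathfrak p])=0$, and $\mathfrak p$ is maximal (with respect to inclusion) among all subspaces $W$ of $\mathfrak u$ with $f([W,W])=0$. -/

import Mathlib

attribute [local instance] LieRing.ofAssociativeRing

/-- The three families of classical root systems `B_n`, `C_n`, `D_n`. -/
inductive ClassicalType
  | B
  | C
  | D
  deriving DecidableEq

/-- The positive roots of the root system of type `T` and rank `n`: `sub i j` is `ε_i - ε_j` and
`add i j` is `ε_i + ε_j` (for `i < j`, all types), `short i` is `ε_i` (type `B` only), `long i` is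
`2ε_i` (type `C` only). The indices `1, …, n` are represented by `Fin n`. -/
inductive PosRoot : ClassicalType → ℕ → Type
  | sub {T : ClassicalType} {n : ℕ} (i j : Fin n) (h : i < j) : PosRoot T n
  | add {T : ClassicalType} {n : ℕ} (i j : Fin n) (h : i < j) : PosRoot T n
  | short {n : ℕ} (i : Fin n) : PosRoot ClassicalType.B n
  | long {n : ℕ} (i : Fin n) : PosRoot ClassicalType.C n
  deriving DecidableEq

/-- The row and column indices `1, …, n, 0, -n, …, -1` of the matrices in `gl_m(k)`: `pos i` is
`i`, `neg i` is `-i`, and the index `0` is present only in type `B`. There are `m = 2n + 1` of them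
in type `B` and `m = 2n` in types `C` and `D`. -/
inductive MIdx : ClassicalType → ℕ → Type
  | pos {T : ClassicalType} {n : ℕ} (i : Fin n) : MIdx T n
  | zero {n : ℕ} : MIdx ClassicalType.B n
  | neg {T : ClassicalType} {n : ℕ} (i : Fin n) : MIdx T n
  deriving DecidableEq

/-- A linear form `lam` vanishes on all brackets of elements of the subspace `W`. -/
def IsIsotropicFor {k L : Type*} [Field k] [LieRing L] [LieAlgebra k L]
    (lam : Module.Dual k L) (W : Submodule k L) : Prop :=
  ∀ x ∈ W, ∀ y ∈ W, lam ⁅x, y⁆ = 0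

/-- The Lie subalgebra `a` of `L` is a polarization of `L` at the linear form `lam`: it is maximal,
with respect to inclusion, among all *subspaces* `W` of `L` such that `lam([W, W]) = 0`. -/
def IsPolarizationAt {k L : Type*} [Field k] [LieRing L] [LieAlgebra k L]
    (lam : Module.Dual k L) (a : LieSubalgebra k L) : Prop :=
  Maximal (IsIsotropicFor lam) a.toSubmodule

namespace MIdx

instance instFintype (T : ClassicalType) (n : ℕ) : Fintype (MIdx T n) where
  elems := Finset.univ.image pos ∪ Finset.univ.image neg ∪
    (match T with
      | ClassicalType.B => {zero}
      | ClassicalType.C => ∅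
      | ClassicalType.D => ∅)
  complete := by
    intro x
    cases x <;> simp

end MIdx

namespace PosRoot

variable {T : ClassicalType} {n : ℕ}

/-- The root as a vector; all its coordinates in `ℝ^n` are integers. -/
def vec : {T : ClassicalType} → PosRoot T n → (Fin n → ℤ)
  | _, sub i j _ => Pi.single i 1 - Pi.single j 1
  | _, add i j _ => Pi.single i 1 + Pi.single j 1
  | _, short i => Pi.single i 1
  | _, long i => Pi.single i 2

/-- The column of a positive root. -/
def col : {T : ClassicalType} → PosRoot T n → Fin n
  | _, sub i _ _ => i
  | _, add i _ _ => i
  | _, short i => i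
  | _, long i => i

/-- The row of a positive root. -/
def row : {T : ClassicalType} → PosRoot T n → MIdx T n
  | _, sub _ j _ => MIdx.pos j
  | _, add _ j _ => MIdx.neg j
  | _, short _ => MIdx.zero
  | _, long i => MIdx.neg i

/-- The set `S(β)` of `β`-singular roots: positive roots occurring in a decomposition of `β` as a
sum of two positive roots. -/
def singular (β : PosRoot T n) : Set (PosRoot T n) :=
  {α | ∃ γ : PosRoot T n, α.vec + γ.vec = β.vec}

/-- The set `S⁺(β)`: it is `{ε_i + ε_l : i < l ≤ n}` for `β = 2ε_i` (type `C`) and consists of the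
`β`-singular roots in the column of `β` otherwise. -/
def singularPlus : {T : ClassicalType} → PosRoot T n → Set (PosRoot T n)
  | _, long i => {α | ∃ (l : Fin n) (h : i < l), α = add i l h}
  | _, sub i j h => {α | α ∈ singular (sub i j h) ∧ α.col = i}
  | _, add i j h => {α | α ∈ singular (add i j h) ∧ α.col = i}
  | _, short i => {α | α ∈ singular (short i) ∧ α.col = i}

/-- The set `S⁻(β) = S(β) \ S⁺(β)`. -/
def singularMinus (β : PosRoot T n) : Set (PosRoot T n) :=
  singular β \ singularPlus β

/-- The roots of `D` are pairwise orthogonal. -/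
def IsOrthogonalSet (D : Finset (PosRoot T n)) : Prop :=
  ∀ α ∈ D, ∀ β ∈ D, α ≠ β → α.vec ⬝ᵥ β.vec = 0

/-- In type `B`, at most one of the roots `ε_i` lies in `D`; in type `C`, for each pair `i < j` at
most one of the roots `ε_i - ε_j`, `ε_i + ε_j` lies in `D`. (No condition in type `D`.) -/
def IsReducedSet : {T : ClassicalType} → Finset (PosRoot T n) → Prop
  | ClassicalType.B, D => ∀ i j : Fin n, short i ∈ D → short j ∈ D → i = j
  | ClassicalType.C, D => ∀ (i j : Fin n) (h : i < j), ¬ (sub i j h ∈ D ∧ add i j h ∈ D)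
  | ClassicalType.D, _ => True

/-- The set `M_j`, defined by recursion on the column `j`: the roots `γ ∈ S⁻(β)`, where `β ∈ D` is
in column `j`, such that neither `γ` nor `β - γ` lies in a set `M_l` with `l < j`. It is empty when
column `j` contains no root of `D`. -/
def mCol (D : Finset (PosRoot T n)) (j : Fin n) : Set (PosRoot T n) :=
  {γ | ∃ β ∈ D, β.col = j ∧ γ ∈ singularMinus β ∧
    ∀ (l : Fin n) (_ : l < j),
      γ ∉ mCol D l ∧ ∀ δ : PosRoot T n, γ.vec + δ.vec = β.vec → δ ∉ mCol D l}
  termination_by j.val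

/-- The set `P`: the positive roots outside `M`, the union of all the sets `M_j`. -/
def pSet (D : Finset (PosRoot T n)) : Set (PosRoot T n) :=
  {α | ∀ j : Fin n, α ∉ mCol D j}

/-- The root vectors `e_α` as combinations of matrix units:
`e_{j,i} - e_{-i,-j}` for `ε_i - ε_j`,
`e_{-j,i} - e_{-i,j}` (types `B`, `D`) or `e_{-j,i} + e_{-i,j}` (type `C`) for `ε_i + ε_j`,
`e_{0,i} - e_{-i,0}` for `ε_i` and `e_{-i,i}` for `2ε_i`. -/
def rootMatrix (k : Type*) [Field k] :
    {T : ClassicalType} → PosRoot T n → Matrix (MIdx T n) (MIdx T n) k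
  | _, sub i j _ =>
      Matrix.single (MIdx.pos j) (MIdx.pos i) 1 - Matrix.single (MIdx.neg i) (MIdx.neg j) 1
  | ClassicalType.C, add i j _ =>
      Matrix.single (MIdx.neg j) (MIdx.pos i) 1 + Matrix.single (MIdx.neg i) (MIdx.pos j) 1
  | ClassicalType.B, add i j _ =>
      Matrix.single (MIdx.neg j) (MIdx.pos i) 1 - Matrix.single (MIdx.neg i) (MIdx.pos j) 1
  | ClassicalType.D, add i j _ =>
      Matrix.single (MIdx.neg j) (MIdx.pos i) 1 - Matrix.single (MIdx.neg i) (MIdx.pos j) 1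
  | _, short i =>
      Matrix.single MIdx.zero (MIdx.pos i) 1 - Matrix.single (MIdx.neg i) MIdx.zero 1
  | _, long i => Matrix.single (MIdx.neg i) (MIdx.pos i) 1

theorem addMatrix_mem_B (k : Type*) [Field k] (a b : Fin n) :
    (Matrix.single (MIdx.neg b) (MIdx.pos a) 1 - Matrix.single (MIdx.neg a) (MIdx.pos b) 1 :
      Matrix (MIdx ClassicalType.B n) (MIdx ClassicalType.B n) k) ∈
      Submodule.span k (Set.range (rootMatrix k)) := by
  rcases lt_trichotomy a b with h | h | h
  · exact Submodule.subset_span ⟨add a b h, rfl⟩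
  · subst h; simp
  · rw [← neg_sub]
    exact Submodule.neg_mem _ (Submodule.subset_span ⟨add b a h, rfl⟩)

theorem addMatrix_mem_D (k : Type*) [Field k] (a b : Fin n) :
    (Matrix.single (MIdx.neg b) (MIdx.pos a) 1 - Matrix.single (MIdx.neg a) (MIdx.pos b) 1 :
      Matrix (MIdx ClassicalType.D n) (MIdx ClassicalType.D n) k) ∈
      Submodule.span k (Set.range (rootMatrix k)) := by
  rcases lt_trichotomy a b with h | h | h
  · exact Submodule.subset_span ⟨add a b h, rfl⟩
  · subst h; simp
  · rw [← neg_sub]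
    exact Submodule.neg_mem _ (Submodule.subset_span ⟨add b a h, rfl⟩)

theorem addMatrix_mem_C (k : Type*) [Field k] (a b : Fin n) :
    (Matrix.single (MIdx.neg b) (MIdx.pos a) 1 + Matrix.single (MIdx.neg a) (MIdx.pos b) 1 :
      Matrix (MIdx ClassicalType.C n) (MIdx ClassicalType.C n) k) ∈
      Submodule.span k (Set.range (rootMatrix k)) := by
  rcases lt_trichotomy a b with h | h | h
  · exact Submodule.subset_span ⟨add a b h, rfl⟩
  · subst h
    exact Submodule.add_mem _ (Submodule.subset_span ⟨long a, rfl⟩)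
      (Submodule.subset_span ⟨long a, rfl⟩)
  · rw [add_comm]
    exact Submodule.subset_span ⟨add b a h, rfl⟩

theorem single_mul_single_ite {ι k : Type*} [Fintype ι] [DecidableEq ι] [Field k]
    (a b c d : ι) (x y : k) :
    Matrix.single a b x * Matrix.single c d y = if b = c then Matrix.single a d (x * y) else 0 := by
  split_ifs with h
  · subst h; simp
  · simp [h]

theorem lie_sub_sub_mem (k : Type*) [Field k] (i j p q : Fin n) (h : i < j) (h' : p < q) :
    ⁅(rootMatrix k (sub i j h) : Matrix (MIdx T n) (MIdx T n) k),
      (rootMatrix k (sub p q h') : Matrix (MIdx T n) (MIdx T n) k)⁆ ∈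
      Submodule.span k (Set.range (rootMatrix k : PosRoot T n → Matrix _ _ k)) := by
  have key : ⁅(rootMatrix k (sub i j h) : Matrix (MIdx T n) (MIdx T n) k),
      (rootMatrix k (sub p q h') : Matrix (MIdx T n) (MIdx T n) k)⁆ =
      (if i = q then
        Matrix.single (MIdx.pos j) (MIdx.pos p) 1 - Matrix.single (MIdx.neg p) (MIdx.neg j) 1
        else 0) -
      (if p = j then
        Matrix.single (MIdx.pos q) (MIdx.pos i) 1 - Matrix.single (MIdx.neg i) (MIdx.neg q) 1
        else 0) := by
    simp only [rootMatrix, Ring.lie_def, mul_sub, sub_mul, single_mul_single_ite,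
      MIdx.pos.injEq, MIdx.neg.injEq, reduceCtorEq, if_false, mul_one, eq_comm (a := j),
      eq_comm (a := q)]
    split_ifs <;> abel
  rw [key]
  refine Submodule.sub_mem _ ?_ ?_
  · split_ifs with e
    · subst e
      exact Submodule.subset_span ⟨sub p j (h'.trans h), by simp [rootMatrix]⟩
    · exact Submodule.zero_mem _
  · split_ifs with e
    · subst e
      exact Submodule.subset_span ⟨sub i q (h.trans h'), by simp [rootMatrix]⟩
    · exact Submodule.zero_mem _

theorem lie_sub_add_mem (k : Type*) [Field k] (i j p q : Fin n) (h : i < j) (h' : p < q) :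
    ⁅(rootMatrix k (sub i j h) : Matrix (MIdx T n) (MIdx T n) k),
      (rootMatrix k (add p q h') : Matrix (MIdx T n) (MIdx T n) k)⁆ ∈
      Submodule.span k (Set.range (rootMatrix k : PosRoot T n → Matrix _ _ k)) := by
  have aux : ∀ {M : Submodule k (Matrix (MIdx T n) (MIdx T n) k)} {c : Prop} [Decidable c]
      {x : Matrix (MIdx T n) (MIdx T n) k}, x ∈ M → (if c then x else 0) ∈ M := by
    intro M c _ x hx
    split_ifs
    · exact hx
    · exact M.zero_mem
  cases T with
  | B =>
    have key : ⁅(rootMatrix k (sub i j h) : Matrix (MIdx .B n) (MIdx .B n) k),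
        (rootMatrix k (add p q h') : Matrix (MIdx .B n) (MIdx .B n) k)⁆ =
        (if q = j then
          Matrix.single (MIdx.neg p) (MIdx.pos i) 1 - Matrix.single (MIdx.neg i) (MIdx.pos p) 1
          else 0) -
        (if p = j then
          Matrix.single (MIdx.neg q) (MIdx.pos i) 1 - Matrix.single (MIdx.neg i) (MIdx.pos q) 1
          else 0) := by
      simp only [rootMatrix, Ring.lie_def, mul_sub, sub_mul, single_mul_single_ite,
        MIdx.pos.injEq, MIdx.neg.injEq, reduceCtorEq, if_false, mul_one, eq_comm (a := j)]
      split_ifs <;> abel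
    rw [key]
    exact Submodule.sub_mem _ (aux (addMatrix_mem_B k _ _)) (aux (addMatrix_mem_B k _ _))
  | C =>
    have key : ⁅(rootMatrix k (sub i j h) : Matrix (MIdx .C n) (MIdx .C n) k),
        (rootMatrix k (add p q h') : Matrix (MIdx .C n) (MIdx .C n) k)⁆ =
        - (if q = j then
          Matrix.single (MIdx.neg p) (MIdx.pos i) 1 + Matrix.single (MIdx.neg i) (MIdx.pos p) 1
          else 0) -
        (if p = j then
          Matrix.single (MIdx.neg q) (MIdx.pos i) 1 + Matrix.single (MIdx.neg i) (MIdx.pos q) 1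
          else 0) := by
      simp only [rootMatrix, Ring.lie_def, mul_sub, sub_mul, mul_add, add_mul,
        single_mul_single_ite,
        MIdx.pos.injEq, MIdx.neg.injEq, reduceCtorEq, if_false, mul_one, eq_comm (a := j)]
      split_ifs <;> abel
    rw [key]
    exact Submodule.sub_mem _ (Submodule.neg_mem _ (aux (addMatrix_mem_C k _ _)))
      (aux (addMatrix_mem_C k _ _))
  | D =>
    have key : ⁅(rootMatrix k (sub i j h) : Matrix (MIdx .D n) (MIdx .D n) k),
        (rootMatrix k (add p q h') : Matrix (MIdx .D n) (MIdx .D n) k)⁆ =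
        (if q = j then
          Matrix.single (MIdx.neg p) (MIdx.pos i) 1 - Matrix.single (MIdx.neg i) (MIdx.pos p) 1
          else 0) -
        (if p = j then
          Matrix.single (MIdx.neg q) (MIdx.pos i) 1 - Matrix.single (MIdx.neg i) (MIdx.pos q) 1
          else 0) := by
      simp only [rootMatrix, Ring.lie_def, mul_sub, sub_mul, single_mul_single_ite,
        MIdx.pos.injEq, MIdx.neg.injEq, reduceCtorEq, if_false, mul_one, eq_comm (a := j)]
      split_ifs <;> abel
    rw [key]
    exact Submodule.sub_mem _ (aux (addMatrix_mem_D k _ _)) (aux (addMatrix_mem_D k _ _))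

theorem lie_sub_short_mem (k : Type*) [Field k] (i j p : Fin n) (h : i < j) :
    ⁅(rootMatrix k (sub i j h) : Matrix (MIdx .B n) (MIdx .B n) k), rootMatrix k (short p)⁆ ∈
      Submodule.span k (Set.range (rootMatrix k : PosRoot .B n → Matrix _ _ k)) := by
  have key : ⁅(rootMatrix k (sub i j h) : Matrix (MIdx .B n) (MIdx .B n) k),
      rootMatrix k (short p)⁆ = - (if p = j then rootMatrix k (short i) else 0) := by
    simp only [rootMatrix, Ring.lie_def, mul_sub, sub_mul, single_mul_single_ite,
      MIdx.pos.injEq, MIdx.neg.injEq, reduceCtorEq, if_false, mul_one, eq_comm (a := j)]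
    split_ifs <;> abel
  rw [key]
  refine Submodule.neg_mem _ ?_
  split_ifs
  · exact Submodule.subset_span ⟨short i, rfl⟩
  · exact Submodule.zero_mem _

theorem lie_sub_long_mem (k : Type*) [Field k] (i j p : Fin n) (h : i < j) :
    ⁅(rootMatrix k (sub i j h) : Matrix (MIdx .C n) (MIdx .C n) k), rootMatrix k (long p)⁆ ∈
      Submodule.span k (Set.range (rootMatrix k : PosRoot .C n → Matrix _ _ k)) := by
  have key : ⁅(rootMatrix k (sub i j h) : Matrix (MIdx .C n) (MIdx .C n) k),
      rootMatrix k (long p)⁆ = - (if p = j then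
        Matrix.single (MIdx.neg p) (MIdx.pos i) 1 + Matrix.single (MIdx.neg i) (MIdx.pos p) 1
        else 0) := by
    simp only [rootMatrix, Ring.lie_def, mul_sub, sub_mul, single_mul_single_ite,
      MIdx.pos.injEq, MIdx.neg.injEq, reduceCtorEq, if_false, mul_one, eq_comm (a := j)]
    split_ifs <;> abel
  rw [key]
  refine Submodule.neg_mem _ ?_
  split_ifs
  · exact addMatrix_mem_C k _ _
  · exact Submodule.zero_mem _

/-- The bracket of two root vectors is in the span of the root vectors. -/
theorem lie_rootMatrix_mem (k : Type*) [Field k] (α β : PosRoot T n) :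
    ⁅rootMatrix k α, rootMatrix k β⁆ ∈
      Submodule.span k (Set.range (rootMatrix k : PosRoot T n → Matrix _ _ k)) := by
  cases α with
  | sub i j h =>
    cases β with
    | sub p q h' => exact lie_sub_sub_mem k i j p q h h'
    | add p q h' => exact lie_sub_add_mem k i j p q h h'
    | short p => exact lie_sub_short_mem k i j p h
    | long p => exact lie_sub_long_mem k i j p h
  | add i j h =>
    cases β with
    | sub p q h' =>
      rw [← lie_skew]
      exact Submodule.neg_mem _ (lie_sub_add_mem k p q i j h' h)
    | add p q h' =>
      cases T <;> simp [rootMatrix, Ring.lie_def, mul_sub, sub_mul, mul_add, add_mul]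
    | short p => simp [rootMatrix, Ring.lie_def, mul_sub, sub_mul]
    | long p => simp [rootMatrix, Ring.lie_def, mul_add, add_mul]
  | short i =>
    cases β with
    | sub p q h' =>
      rw [← lie_skew]
      exact Submodule.neg_mem _ (lie_sub_short_mem k p q i h')
    | add p q h' => simp [rootMatrix, Ring.lie_def, mul_sub, sub_mul]
    | short p =>
      have key : ⁅(rootMatrix k (short i) : Matrix (MIdx .B n) (MIdx .B n) k),
          rootMatrix k (short p)⁆ = Matrix.single (MIdx.neg p) (MIdx.pos i) 1 -
            Matrix.single (MIdx.neg i) (MIdx.pos p) 1 := by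
        simp [rootMatrix, Ring.lie_def, mul_sub, sub_mul]
        abel
      rw [key]
      exact addMatrix_mem_B k _ _
  | long i =>
    cases β with
    | sub p q h' =>
      rw [← lie_skew]
      exact Submodule.neg_mem _ (lie_sub_long_mem k p q i h')
    | add p q h' => simp [rootMatrix, Ring.lie_def, mul_add, add_mul]
    | long p => simp [rootMatrix, Ring.lie_def]

/-- The coefficient of `e_α` in `e_β`, read off at the position `(row α, col α)`. -/
theorem rootMatrix_apply (k : Type*) [Field k] (α β : PosRoot T n) :
    rootMatrix k β α.row (MIdx.pos α.col) = if β = α then 1 else 0 := by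
  cases α <;> cases β <;> (try cases T) <;>
    simp [rootMatrix, row, col, Matrix.single_apply, and_comm] <;> grind

/-- The Lie algebra `𝔲`: the subalgebra of `gl_m(k)` spanned, as a vector space, by the root
vectors `e_α`. -/
def nilAlg (k : Type*) [Field k] (T : ClassicalType) (n : ℕ) :
    LieSubalgebra k (Matrix (MIdx T n) (MIdx T n) k) where
  toSubmodule := Submodule.span k (Set.range (rootMatrix k))
  lie_mem' := by
    intro x y hx hy
    have hx' : x ∈ Submodule.span k (Set.range (rootMatrix k : PosRoot T n → _)) := hx
    have hy' : y ∈ Submodule.span k (Set.range (rootMatrix k : PosRoot T n → _)) := hy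
    change ⁅x, y⁆ ∈ Submodule.span k (Set.range (rootMatrix k : PosRoot T n → _))
    clear hx hy
    induction hx', hy' using Submodule.span_induction₂ with
    | mem_mem x y hx hy =>
      obtain ⟨α, rfl⟩ := hx
      obtain ⟨β, rfl⟩ := hy
      exact lie_rootMatrix_mem k α β
    | zero_left => simp
    | zero_right => simp
    | add_left x y z _ _ _ h1 h2 => rw [add_lie]; exact Submodule.add_mem _ h1 h2
    | add_right x y z _ _ _ h1 h2 => rw [lie_add]; exact Submodule.add_mem _ h1 h2
    | smul_left r x y _ _ h => rw [smul_lie]; exact Submodule.smul_mem _ _ h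
    | smul_right r x y _ _ h => rw [lie_smul]; exact Submodule.smul_mem _ _ h

/-- The root vector `e_α` as an element of `𝔲`. -/
def rootVec (k : Type*) [Field k] (α : PosRoot T n) : nilAlg k T n :=
  ⟨rootMatrix k α, Submodule.subset_span ⟨α, rfl⟩⟩

/-- The covector `e_β^*` dual to `e_β`: it takes `x ∈ 𝔲` to its entry in position
`(row β, col β)`. -/
def dualVec (k : Type*) [Field k] (β : PosRoot T n) : Module.Dual k (nilAlg k T n) where
  toFun x := (x : Matrix (MIdx T n) (MIdx T n) k) β.row (MIdx.pos β.col)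
  map_add' _ _ := rfl
  map_smul' _ _ := rfl

/-- The defining property of the dual covectors. -/
theorem dualVec_rootVec (k : Type*) [Field k] (α β : PosRoot T n) :
    dualVec k β (rootVec k α) = if α = β then 1 else 0 :=
  rootMatrix_apply k β α

/-- The canonical form `f = ∑_{β ∈ D} ξ_β e_β^*`. -/
def canonicalForm {k : Type*} [Field k] (D : Finset (PosRoot T n)) (ξ : PosRoot T n → k) :
    Module.Dual k (nilAlg k T n) :=
  ∑ β ∈ D, ξ β • dualVec k β

/-- The subspace `𝔭₀`, spanned by the vectors
`ξ_{ε_i + ε_j} e_{ε_l - ε_j} - ξ_{ε_i - ε_j} e_{ε_l + ε_j}`, where `i < l < j`, both roots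
`ε_i ± ε_j` are in `D`, both roots `ε_l ± ε_j` are in `M_i`, and row `-l` contains no root
of `D`. -/
def pZero {k : Type*} [Field k] (D : Finset (PosRoot T n)) (ξ : PosRoot T n → k) :
    Submodule k (nilAlg k T n) :=
  Submodule.span k
    {x | ∃ (i l j : Fin n) (hil : i < l) (hlj : l < j),
      sub i j (hil.trans hlj) ∈ D ∧ add i j (hil.trans hlj) ∈ D ∧
      sub l j hlj ∈ mCol D i ∧ add l j hlj ∈ mCol D i ∧
      (∀ β ∈ D, β.row ≠ MIdx.neg l) ∧
      x = ξ (add i j (hil.trans hlj)) • rootVec k (sub l j hlj) -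
        ξ (sub i j (hil.trans hlj)) • rootVec k (add l j hlj)}

/-- The subspace `𝔭 = ∑_{α ∈ P} k e_α + 𝔭₀` of `𝔲`. -/
def pSpace {k : Type*} [Field k] (D : Finset (PosRoot T n)) (ξ : PosRoot T n → k) :
    Submodule k (nilAlg k T n) :=
  Submodule.span k (rootVec k '' pSet D) ⊔ pZero D ξ

end PosRoot

/-!
Maximality of an isotropic subspace `W` amounts to `{x : f([W, x]) = 0} ⊆ W`, and everything rests
on one combinatorial description of the decompositions of a root. `Splits β δ γ` says that
`β = δ + γ` with `δ ∈ S⁺(β)` and `γ ∈ S⁻(β)`; every decomposition of `β` has this form, up to the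
order of the summands. The summand `δ` has the column of `β`, and `γ` has a larger one, except for
`β = 2ε_i`. By definition, if `β ∈ D` and `γ ∈ P`, then `δ` lies in some `M_l` with `l < col β`
(`Splits.exists_mem_mCol`). Three consequences carry the proof.

* `f([e_α, e_γ]) = 0` for `α, γ ∈ P`: otherwise `α + γ ∈ D`, so that one of them lies in `M`.
* `P` is closed under sums that are roots (`mem_pSet_of_splits`). If `β = δ + (a + b)` puts `a + b`
  into `M_j`, then `a + δ` or `b + δ` is a root (`Splits.assoc`), and if neither `a` nor `b` is in
  `M_l` for some `l ≤ j`, this root is a sum of the same kind in `M_l` for some `l < j`.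
* If `f([𝔭, x]) = 0`, then the coefficient of `x` at `γ ∈ M_j` vanishes, unless `γ` occurs in a
  generator of `𝔭₀`, by induction on `j` (`coeff_eq_zero`). If `β = δ + γ` is the decomposition
  that puts `γ` into `M_j`, then `δ ∈ P`, and all terms of `f([e_δ, x])` except the one of `γ`
  vanish by induction, unless `D` contains two roots in column `j`.

In the last case these two roots are `ε_j - ε_r` and `ε_j + ε_r`, the type is `B` or `D`, and
`γ = ε_l ± ε_r` for some `l`. Of the roots `ε_l ± ε_r`, one that is not in `M_j` lies in an earlier
set, so that its coefficient vanishes. When both are in `M_j`, the equation `f([e_δ, x]) = 0` is one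
linear relation between their two coefficients (`coeff_pair`). If no root of `D` has row `-l`
(`IsTwin`), the relation says that this part of `x` is a multiple of a generator of `𝔭₀`. If
`ε_t + ε_l ∈ D`, then `(j, t, r)` is the triple of a generator of `𝔭₀` (`isTwin_of_add_mem`), and
its bracket with `x` is a second relation, independent of the first one as `2 ≠ 0`
(`coeff_eq_zero_of_twin`).

That the generators of `𝔭₀` are compatible with `P` is a matter of the few decompositions which
involve `ε_l ± ε_r` (`IsTwin.splits`, `IsTwin.of_sub_mem`): orthogonality lets every index
occur in `D` with one partner only, which determines the roots of `D` that can put a given root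
into `M`.
-/

namespace PosRoot

section Combinatorics
variable {T : ClassicalType} {n : ℕ}

/-! ### Decompositions of a positive root into two positive roots -/

/-- `Splits β δ γ`: `β = δ + γ` with `δ ∈ S⁺(β)` and `γ ∈ S⁻(β)`, written out as equations between
the indices. The inequalities between the indices are implied by those in the roots. -/
def Splits : {T : ClassicalType} → PosRoot T n → PosRoot T n → PosRoot T n → Prop
  | _, sub i k _, sub i' j _, sub j' k' _ => i' = i ∧ j' = j ∧ k' = k
  | _, add i k _, sub i' j _, add a b _ => i' = i ∧ (a = j ∧ b = k ∨ a = k ∧ b = j)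
  | _, add i k _, add i' j _, sub a b _ => i' = i ∧ a = k ∧ b = j
  | _, add i k _, sub i' j _, long a => i' = i ∧ j = k ∧ a = k
  | _, long i, add i' j _, sub a b _ => i' = i ∧ a = i ∧ b = j
  | _, short i, sub i' j _, short a => i' = i ∧ a = j
  | _, add i k _, short a, short b => a = i ∧ b = k
  | _, _, _, _ => False

set_option maxHeartbeats 1000000 in
/-- Every decomposition of a positive root is one of the listed ones, in one of the two orders. -/
theorem splits_of_vec_add_eq {α γ β : PosRoot T n} (h : α.vec + γ.vec = β.vec) :
    Splits β α γ ∨ Splits β γ α := by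
  have h' := fun t => congrFun h t
  clear h
  rcases α with ⟨i, j, hij⟩ | ⟨i, j, hij⟩ | i | i <;>
  rcases γ with ⟨p, q, hpq⟩ | ⟨p, q, hpq⟩ | p | p <;>
  rcases β with ⟨r, s, hrs⟩ | ⟨r, s, hrs⟩ | r | r <;>
  simp only [vec, Pi.add_apply, Pi.sub_apply, Pi.single_apply] at h' <;>
  simp only [Splits] <;> have e₁ := h' i <;> have e₂ := h' p <;> have e₃ := h' r <;>
  try have e₄ := h' j
  all_goals try have e₅ := h' q
  all_goals try have e₆ := h' s
  all_goals clear h'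
  all_goals grind

theorem Splits.vec_add {α γ β : PosRoot T n} (h : Splits β α γ) : α.vec + γ.vec = β.vec := by
  rcases α with ⟨i, j, hij⟩ | ⟨i, j, hij⟩ | i | i <;>
  rcases γ with ⟨p, q, hpq⟩ | ⟨p, q, hpq⟩ | p | p <;>
  rcases β with ⟨r, s, hrs⟩ | ⟨r, s, hrs⟩ | r | r <;>
  simp only [Splits] at h <;>
  ext t <;> simp only [vec, Pi.add_apply, Pi.sub_apply, Pi.single_apply] <;> grind

theorem vec_injective : Function.Injective (vec : PosRoot T n → Fin n → ℤ) := by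
  intro α β h
  have h' := fun t => congrFun h t
  clear h
  rcases α with ⟨i, j, hij⟩ | ⟨i, j, hij⟩ | i | i <;>
  rcases β with ⟨p, q, hpq⟩ | ⟨p, q, hpq⟩ | p | p <;>
  simp only [vec, Pi.add_apply, Pi.sub_apply, Pi.single_apply] at h' <;>
  have e₁ := h' i <;> have e₂ := h' p <;> try have e₃ := h' j
  all_goals try have e₄ := h' q
  all_goals clear h'
  all_goals grind

theorem Splits.col_left {α γ β : PosRoot T n} (h : Splits β α γ) : α.col = β.col := by
  rcases α with ⟨i, j, hij⟩ | ⟨i, j, hij⟩ | i | i <;>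
  rcases γ with ⟨p, q, hpq⟩ | ⟨p, q, hpq⟩ | p | p <;>
  rcases β with ⟨r, s, hrs⟩ | ⟨r, s, hrs⟩ | r | r <;>
  simp only [Splits] at h <;> simp only [col] <;> grind

theorem mem_singularMinus_iff {β γ : PosRoot T n} :
    γ ∈ singularMinus β ↔ ∃ δ, Splits β δ γ := by
  constructor
  · rintro ⟨⟨δ, hδ⟩, hγ⟩
    rcases splits_of_vec_add_eq hδ with h | h
    · refine absurd ?_ hγ
      have hs : γ ∈ singular β := ⟨δ, hδ⟩
      have hc := h.col_left
      cases β with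
      | long i =>
        cases γ <;> cases δ <;> simp only [Splits] at h
        obtain ⟨rfl, -, -⟩ := h
        exact ⟨_, ‹_›, rfl⟩
      | sub => exact ⟨hs, hc⟩
      | add => exact ⟨hs, hc⟩
      | short => exact ⟨hs, hc⟩
    · exact ⟨δ, h⟩
  · rintro ⟨δ, h⟩
    refine ⟨⟨δ, by rw [add_comm]; exact h.vec_add⟩, ?_⟩
    cases β <;> cases γ <;> cases δ <;> simp only [Splits] at h <;>
      simp only [singularPlus, col, Set.mem_ofPred_eq] <;> grind

theorem Splits.right_unique {β δ γ γ' : PosRoot T n} (h : Splits β δ γ) (h' : Splits β δ γ') :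
    γ = γ' :=
  vec_injective (add_left_cancel (h.vec_add.trans h'.vec_add.symm))

/-- If `β = δ + (a + b)`, then `b + δ` or `a + δ` is a root `ρ`, with complement in `S⁻(β)`. -/
theorem Splits.assoc {β δ σ a b : PosRoot T n} (h : Splits β δ σ) (h' : Splits σ a b) :
    (∃ ρ, Splits β ρ a ∧ (Splits ρ δ b ∨ Splits ρ b δ)) ∨
      ∃ ρ, Splits β ρ b ∧ (Splits ρ δ a ∨ Splits ρ a δ) := by
  rcases β with ⟨i, k, hik⟩ | ⟨i, k, hik⟩ | i | i <;>
  rcases δ with ⟨i', j, hij⟩ | ⟨i', j, hij⟩ | i' | i' <;>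
  rcases σ with ⟨p, q, hpq⟩ | ⟨p, q, hpq⟩ | p | p <;> simp only [Splits] at h
  · rcases a with ⟨p', m, hm⟩ | ⟨p', m, hm⟩ | p' | p' <;>
    rcases b with ⟨m', r, hr⟩ | ⟨m', r, hr⟩ | m' | m' <;> simp only [Splits] at h'
    exact Or.inr ⟨sub i m (by order), by simp only [Splits]; grind⟩
  · rcases a with ⟨p', m, hm⟩ | ⟨p', m, hm⟩ | p' | p' <;>
    rcases b with ⟨m', r, hr⟩ | ⟨m', r, hr⟩ | m' | m' <;> simp only [Splits] at h'
    · rcases h.2 with h2 | h2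
      · exact Or.inr ⟨sub i m (by order), by simp only [Splits]; grind⟩
      · exact Or.inl ⟨add i m (by order), by simp only [Splits]; grind⟩
    · rcases h.2 with h2 | h2
      · exact Or.inr ⟨sub i m (by order), by simp only [Splits]; grind⟩
      · exact Or.inl ⟨add i m (by order), by simp only [Splits]; grind⟩
    · rcases h.2 with h2 | h2
      · exact Or.inr ⟨add i m (by order), by simp only [Splits]; grind⟩
      · exact Or.inl ⟨sub i m (by order), by simp only [Splits]; grind⟩
    · rcases h.2 with h2 | h2
      · exact Or.inr ⟨short i, by simp only [Splits]; grind⟩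
      · exact Or.inl ⟨short i, by simp only [Splits]; grind⟩
  · rcases a with ⟨p', m, hm⟩ | ⟨p', m, hm⟩ | p' | p' <;>
    rcases b with ⟨m', r, hr⟩ | ⟨m', r, hr⟩ | m' | m' <;> simp only [Splits] at h'
    exact Or.inl ⟨sub i m (by order), by simp only [Splits]; grind⟩
  · rcases a with ⟨p', m, hm⟩ | ⟨p', m, hm⟩ | p' | p' <;>
    rcases b with ⟨m', r, hr⟩ | ⟨m', r, hr⟩ | m' | m' <;> simp only [Splits] at h'
    exact Or.inl ⟨add i m (by order), by simp only [Splits]; grind⟩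
  · rcases a with ⟨p', m, hm⟩ | ⟨p', m, hm⟩ | p' | p' <;>
    rcases b with ⟨m', r, hr⟩ | ⟨m', r, hr⟩ | m' | m' <;> simp only [Splits] at h'
    exact Or.inl ⟨add i m (by order), by simp only [Splits]; grind⟩
  · rcases a with ⟨p', m, hm⟩ | ⟨p', m, hm⟩ | p' | p' <;>
    rcases b with ⟨m', r, hr⟩ | ⟨m', r, hr⟩ | m' | m' <;> simp only [Splits] at h'
    exact Or.inr ⟨sub i m (by order), by simp only [Splits]; grind⟩
  · rcases a with ⟨p', m, hm⟩ | ⟨p', m, hm⟩ | p' | p' <;>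
    rcases b with ⟨m', r, hr⟩ | ⟨m', r, hr⟩ | m' | m' <;> simp only [Splits] at h'
    exact Or.inl ⟨add i m (by order), by simp only [Splits]; grind⟩

/-! ### The sets `M_j` and closedness of `P` -/

/-- The recursion for `M_j`, with the complement `β - γ` as a root `δ`. -/
theorem mem_mCol_iff {D : Finset (PosRoot T n)} {j : Fin n} {γ : PosRoot T n} :
    γ ∈ mCol D j ↔ ∃ β ∈ D, ∃ δ, Splits β δ γ ∧ β.col = j ∧
      ∀ l < j, γ ∉ mCol D l ∧ δ ∉ mCol D l := by
  rw [mCol]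
  constructor
  · rintro ⟨β, hβ, hc, hγ, h⟩
    obtain ⟨δ, hδ⟩ := mem_singularMinus_iff.1 hγ
    exact ⟨β, hβ, δ, hδ, hc, fun l hl => ⟨(h l hl).1,
      (h l hl).2 δ (by rw [add_comm]; exact hδ.vec_add)⟩⟩
  · rintro ⟨β, hβ, δ, hδ, hc, h⟩
    refine ⟨β, hβ, hc, mem_singularMinus_iff.2 ⟨δ, hδ⟩, fun l hl => ⟨(h l hl).1, fun ε hε => ?_⟩⟩
    rw [← hδ.vec_add, add_comm] at hε
    rw [vec_injective (add_right_cancel hε)]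
    exact (h l hl).2

theorem mem_pSet_iff {D : Finset (PosRoot T n)} {α : PosRoot T n} :
    α ∈ pSet D ↔ ∀ j, α ∉ mCol D j := Iff.rfl

/-- If `γ ∈ S⁻(β) ∩ P` for some `β ∈ D`, then only the complement `β - γ`, lying in an earlier set
`M_l`, can have kept `γ` out of `M`. -/
theorem Splits.exists_mem_mCol {D : Finset (PosRoot T n)} {β δ γ : PosRoot T n}
    (h : Splits β δ γ) (hβ : β ∈ D) (hγ : γ ∈ pSet D) : ∃ l < β.col, δ ∈ mCol D l := by
  by_contra! hc
  exact hγ _ (mem_mCol_iff.2 ⟨β, hβ, δ, h, rfl, fun l hl => ⟨hγ l, hc l hl⟩⟩)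

/-- A sum that lies in `M_j` has a summand in some `M_l` with `l ≤ j`. -/
theorem mCol_of_splits {D : Finset (PosRoot T n)} (j : Fin n) :
    ∀ {σ a b : PosRoot T n}, Splits σ a b → σ ∈ mCol D j →
      (∃ l ≤ j, a ∈ mCol D l) ∨ ∃ l ≤ j, b ∈ mCol D l := by
  induction j using WellFoundedLT.induction with
  | ind j ih =>
  intro σ a b hσ hm
  obtain ⟨β, hβ, δ, hδ, rfl, hl⟩ := mem_mCol_iff.1 hm
  have key : ∀ x y ρ : PosRoot T n, Splits β ρ x → (Splits ρ δ y ∨ Splits ρ y δ) →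
      (∃ l ≤ β.col, x ∈ mCol D l) ∨ ∃ l ≤ β.col, y ∈ mCol D l := by
    intro x y ρ h1 h2
    by_contra! hc
    have h3 : ∃ l < β.col, ρ ∈ mCol D l := by
      by_contra! h3
      exact hc.1 _ le_rfl (mem_mCol_iff.2 ⟨β, hβ, ρ, h1, rfl, fun l h => ⟨hc.1 l h.le, h3 l h⟩⟩)
    obtain ⟨l, hlt, hρ⟩ := h3
    have h4 : (∃ l' ≤ l, δ ∈ mCol D l') ∨ ∃ l' ≤ l, y ∈ mCol D l' := by
      rcases h2 with h2 | h2
      · exact ih l hlt h2 hρ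
      · exact (ih l hlt h2 hρ).symm
    rcases h4 with ⟨l', h5, h6⟩ | ⟨l', h5, h6⟩
    · exact (hl l' (h5.trans_lt hlt)).2 h6
    · exact hc.2 l' (h5.trans hlt.le) h6
  -- `key` covers both cases: `x` is the summand complementary to `ρ`, and `ρ = δ + y` lies in an
  -- earlier set `M_l`, to which the induction hypothesis applies.
  rcases hδ.assoc hσ with ⟨ρ, h1, h2⟩ | ⟨ρ, h1, h2⟩
  · exact key a b ρ h1 h2
  · exact (key b a ρ h1 h2).symm

/-- The set `P` is closed under sums that are roots. -/
theorem mem_pSet_of_splits {D : Finset (PosRoot T n)} {σ a b : PosRoot T n}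
    (h : Splits σ a b) (ha : a ∈ pSet D) (hb : b ∈ pSet D) : σ ∈ pSet D := by
  intro j hj
  rcases mCol_of_splits j h hj with ⟨l, -, h⟩ | ⟨l, -, h⟩
  · exact ha l h
  · exact hb l h

/-- A root in `S⁺(β)` with `β ∈ D` lies in `S⁻(β')` only for those `β' ∈ D` which have a smaller
column. The equality of columns would need a long root `β'`, hence `β = β'` by orthogonality. -/
theorem Splits.col_lt_of_mem {D : Finset (PosRoot T n)} (hD : IsOrthogonalSet D)
    {β δ γ β' α : PosRoot T n} (h : Splits β δ γ) (h' : Splits β' α δ) (hβ : β ∈ D)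
    (hβ' : β' ∈ D) : β'.col < β.col := by
  have hc := h.col_left
  have hc' := h'.col_left
  have key := hD β hβ β' hβ'
  rw [← hc]
  rcases δ with ⟨i, j, hij⟩ | ⟨i, j, hij⟩ | i | i <;>
  rcases α with ⟨p, q, hpq⟩ | ⟨p, q, hpq⟩ | p | p <;>
  rcases β' with ⟨r, s, hrs⟩ | ⟨r, s, hrs⟩ | r | r <;>
  simp only [Splits] at h' <;> simp only [col] <;> try grind
  have hβr : β ≠ long r := by
    rintro rfl
    cases γ <;> simp only [Splits] at h
  have h0 := key hβr
  rw [vec, dotProduct_single] at h0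
  rcases β with ⟨i', k, hik⟩ | ⟨i', k, hik⟩ | i' | i' <;>
    simp only [vec, col, Pi.add_apply, Pi.sub_apply, Pi.single_apply] at h0 hc hc' <;> grind

/-- The complement of a root of `M_j` is in `P`. -/
theorem Splits.left_mem_pSet {D : Finset (PosRoot T n)} (hD : IsOrthogonalSet D)
    {β δ γ : PosRoot T n} (h : Splits β δ γ) (hβ : β ∈ D)
    (hl : ∀ l < β.col, δ ∉ mCol D l) : δ ∈ pSet D := by
  intro j hj
  obtain ⟨β', hβ', α, hα, rfl, -⟩ := mem_mCol_iff.1 hj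
  exact hl _ (h.col_lt_of_mem hD hα hβ hβ') hj

/-! ### Membership in terms of indices -/

/-- The root `ε_i - ε_j` belongs to `X`. -/
def HasSub {S : Type*} [Membership (PosRoot T n) S] (X : S) (i j : Fin n) : Prop :=
  ∃ h : i < j, sub i j h ∈ X

/-- The root `ε_i + ε_j` belongs to `X`; this includes `i < j`. -/
def HasAdd {S : Type*} [Membership (PosRoot T n) S] (X : S) (i j : Fin n) : Prop :=
  ∃ h : i < j, add i j h ∈ X

/-- The root `ε_i` belongs to `X`. It is identified by its vector, so that the predicate makes sense
in all types (and fails in types `C` and `D`). -/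
def HasShort {S : Type*} [Membership (PosRoot T n) S] (X : S) (i : Fin n) : Prop :=
  ∃ α ∈ X, α.vec = Pi.single i 1

/-- The set `D` contains `ε_i - ε_j` or `ε_i + ε_j`, where `i < j`. -/
def Linked (D : Finset (PosRoot T n)) (i j : Fin n) : Prop := HasSub D i j ∨ HasAdd D i j

/-- By orthogonality an index has at most one partner in `D`. -/
theorem Linked.unique {D : Finset (PosRoot T n)} (hD : IsOrthogonalSet D) {i j p q : Fin n}
    (h : Linked D i j) (h' : Linked D p q) (hc : i = p ∨ i = q ∨ j = p ∨ j = q) :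
    i = p ∧ j = q := by
  rcases h with ⟨hij, h⟩ | ⟨hij, h⟩ <;> rcases h' with ⟨hpq, h'⟩ | ⟨hpq, h'⟩ <;>
  · have key := hD _ h _ h'
    simp only [vec, add_dotProduct, sub_dotProduct, single_dotProduct, Pi.add_apply,
      Pi.sub_apply, Pi.single_apply, ne_eq, sub.injEq, add.injEq, reduceCtorEq] at key
    by_contra hne
    replace key := key (by tauto)
    grind

theorem sub_vec_ne_single {i j p : Fin n} (h : i < j) :
    (sub i j h : PosRoot T n).vec ≠ Pi.single p 1 := by
  intro h'
  have h1 := congrFun h' i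
  have h2 := congrFun h' j
  simp only [vec, Pi.sub_apply, Pi.single_apply] at h1 h2
  grind

theorem add_vec_ne_single {i j p : Fin n} (h : i < j) :
    (add i j h : PosRoot T n).vec ≠ Pi.single p 1 := by
  intro h'
  have h1 := congrFun h' i
  have h2 := congrFun h' j
  simp only [vec, Pi.add_apply, Pi.single_apply] at h1 h2
  grind

theorem hasShort_iff {S : Type*} [Membership (PosRoot .B n) S] (X : S) (i : Fin n) :
    HasShort X i ↔ short i ∈ X := by
  constructor
  · rintro ⟨α, hα, h⟩
    have : α = short i := vec_injective h
    exact this ▸ hα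
  · exact fun h => ⟨_, h, rfl⟩

theorem not_hasShort {S : Type*} [Membership (PosRoot .D n) S] (X : S) (i : Fin n) :
    ¬ HasShort X i := by
  rintro ⟨α, -, h⟩
  cases α
  · exact sub_vec_ne_single _ h
  · exact add_vec_ne_single _ h

theorem Linked.not_hasShort {D : Finset (PosRoot T n)} (hD : IsOrthogonalSet D) {i j p : Fin n}
    (h : Linked D i j) (h' : HasShort D p) : i ≠ p ∧ j ≠ p := by
  obtain ⟨α, h', hα⟩ := h'
  rcases h with ⟨hij, h⟩ | ⟨hij, h⟩
  · have key := hD _ h _ h' (by rintro rfl; exact sub_vec_ne_single _ hα)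
    rw [hα, dotProduct_single] at key
    simp only [vec, Pi.sub_apply, Pi.single_apply] at key
    grind
  · have key := hD _ h _ h' (by rintro rfl; exact add_vec_ne_single _ hα)
    rw [hα, dotProduct_single] at key
    simp only [vec, Pi.add_apply, Pi.single_apply] at key
    grind

theorem HasShort.unique {D : Finset (PosRoot T n)} (hT : T ≠ .C)
    (hred : IsReducedSet D) {p q : Fin n}
    (h : HasShort D p) (h' : HasShort D q) : p = q := by
  cases T with
  | B => exact hred p q ((hasShort_iff D p).1 h) ((hasShort_iff D q).1 h')
  | C => exact absurd rfl hT
  | D => exact absurd h (PosRoot.not_hasShort D p)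

/-- The roots of `D` that can put `ε_a - ε_b` into `M_t` are `ε_t - ε_b` and `ε_t + ε_a`. -/
theorem hasSub_mCol_iff (hT : T ≠ .C) {D : Finset (PosRoot T n)} {t a b : Fin n} :
    HasSub (mCol D t) a b ↔ t < a ∧ a < b ∧ (∀ l < t, ¬ HasSub (mCol D l) a b) ∧
      ((HasSub D t b ∧ ∀ l < t, ¬ HasSub (mCol D l) t a) ∨
        (HasAdd D t a ∧ ∀ l < t, ¬ HasAdd (mCol D l) t b)) := by
  constructor
  · rintro ⟨hab, h⟩
    obtain ⟨β, hβ, δ, hs, rfl, hl⟩ := mem_mCol_iff.1 h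
    rcases β with ⟨i, k, hik⟩ | ⟨i, k, hik⟩ | i | i <;>
    rcases δ with ⟨i', j, hij⟩ | ⟨i', j, hij⟩ | i' | i' <;> simp only [Splits] at hs
    · obtain ⟨rfl, rfl, rfl⟩ := hs
      exact ⟨hij, hab, fun l hlt ⟨_, h⟩ => (hl l hlt).1 h,
        Or.inl ⟨⟨_, hβ⟩, fun l hlt ⟨_, h⟩ => (hl l hlt).2 h⟩⟩
    · obtain ⟨rfl, rfl, rfl⟩ := hs
      exact ⟨hik, hab, fun l hlt ⟨_, h⟩ => (hl l hlt).1 h,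
        Or.inr ⟨⟨_, hβ⟩, fun l hlt ⟨_, h⟩ => (hl l hlt).2 h⟩⟩
    · exact absurd rfl hT
  · rintro ⟨hta, hab, h1, ⟨⟨h2, h3⟩, h4⟩ | ⟨⟨h2, h3⟩, h4⟩⟩
    · exact ⟨hab, mem_mCol_iff.2 ⟨_, h3, sub t a hta, by simp [Splits], rfl,
        fun l hl => ⟨fun h => h1 l hl ⟨_, h⟩, fun h => h4 l hl ⟨_, h⟩⟩⟩⟩
    · exact ⟨hab, mem_mCol_iff.2 ⟨_, h3, add t b (hta.trans hab), by simp [Splits], rfl,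
        fun l hl => ⟨fun h => h1 l hl ⟨_, h⟩, fun h => h4 l hl ⟨_, h⟩⟩⟩⟩

/-- The roots of `D` that can put `ε_a + ε_b` into `M_t` are `ε_t + ε_b` and `ε_t + ε_a`. -/
theorem hasAdd_mCol_iff (hT : T ≠ .C) {D : Finset (PosRoot T n)} {t a b : Fin n} :
    HasAdd (mCol D t) a b ↔ t < a ∧ a < b ∧ (∀ l < t, ¬ HasAdd (mCol D l) a b) ∧
      ((HasAdd D t b ∧ ∀ l < t, ¬ HasSub (mCol D l) t a) ∨
        (HasAdd D t a ∧ ∀ l < t, ¬ HasSub (mCol D l) t b)) := by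
  constructor
  · rintro ⟨hab, h⟩
    obtain ⟨β, hβ, δ, hs, rfl, hl⟩ := mem_mCol_iff.1 h
    rcases β with ⟨i, k, hik⟩ | ⟨i, k, hik⟩ | i | i <;>
    rcases δ with ⟨i', j, hij⟩ | ⟨i', j, hij⟩ | i' | i' <;> simp only [Splits] at hs
    obtain ⟨rfl, ⟨rfl, rfl⟩ | ⟨rfl, rfl⟩⟩ := hs
    · exact ⟨hij, hab, fun l hlt ⟨_, h⟩ => (hl l hlt).1 h,
        Or.inl ⟨⟨_, hβ⟩, fun l hlt ⟨_, h⟩ => (hl l hlt).2 h⟩⟩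
    · exact ⟨hik, hab, fun l hlt ⟨_, h⟩ => (hl l hlt).1 h,
        Or.inr ⟨⟨_, hβ⟩, fun l hlt ⟨_, h⟩ => (hl l hlt).2 h⟩⟩
  · rintro ⟨hta, hab, h1, ⟨⟨h2, h3⟩, h4⟩ | ⟨⟨h2, h3⟩, h4⟩⟩
    · exact ⟨hab, mem_mCol_iff.2 ⟨_, h3, sub t a hta, by simp [Splits], rfl,
        fun l hl => ⟨fun h => h1 l hl ⟨_, h⟩, fun h => h4 l hl ⟨_, h⟩⟩⟩⟩
    · exact ⟨hab, mem_mCol_iff.2 ⟨_, h3, sub t b (hta.trans hab), by simp [Splits], rfl,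
        fun l hl => ⟨fun h => h1 l hl ⟨_, h⟩, fun h => h4 l hl ⟨_, h⟩⟩⟩⟩

/-- The roots of `D` that can put `ε_a` into `M_t` are `ε_t` and `ε_t + ε_a`. -/
theorem hasShort_mCol_iff (hT : T ≠ .C) {D : Finset (PosRoot T n)} {t a : Fin n} :
    HasShort (mCol D t) a ↔ t < a ∧ (∀ l < t, ¬ HasShort (mCol D l) a) ∧
      ((HasShort D t ∧ ∀ l < t, ¬ HasSub (mCol D l) t a) ∨
        (HasAdd D t a ∧ ∀ l < t, ¬ HasShort (mCol D l) t)) ∧ T = .B := by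
  cases T with
  | C => exact absurd rfl hT
  | D => simp [PosRoot.not_hasShort]
  | B =>
    simp only [hasShort_iff, and_true]
    constructor
    · intro h
      obtain ⟨β, hβ, δ, hs, rfl, hl⟩ := mem_mCol_iff.1 h
      rcases β with ⟨i, k, hik⟩ | ⟨i, k, hik⟩ | i | i <;>
      rcases δ with ⟨i', j, hij⟩ | ⟨i', j, hij⟩ | i' | i' <;> simp only [Splits] at hs
      · obtain ⟨rfl, rfl⟩ := hs
        exact ⟨hik, fun l hlt h => (hl l hlt).1 h,
          Or.inr ⟨⟨_, hβ⟩, fun l hlt h => (hl l hlt).2 h⟩⟩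
      · obtain ⟨rfl, rfl⟩ := hs
        exact ⟨hij, fun l hlt h => (hl l hlt).1 h,
          Or.inl ⟨hβ, fun l hlt ⟨_, h⟩ => (hl l hlt).2 h⟩⟩
    · rintro ⟨hta, h1, ⟨h3, h4⟩ | ⟨⟨h2, h3⟩, h4⟩⟩
      · exact mem_mCol_iff.2 ⟨_, h3, sub t a hta, by simp [Splits], rfl,
          fun l hl => ⟨fun h => h1 l hl h, fun h => h4 l hl ⟨_, h⟩⟩⟩
      · exact mem_mCol_iff.2 ⟨_, h3, short t, by simp [Splits], rfl,
          fun l hl => ⟨fun h => h1 l hl h, fun h => h4 l hl h⟩⟩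

/-! ### Twins: the index triples of `𝔭₀` -/

theorem ne_C_of_pair {D : Finset (PosRoot T n)} (hred : IsReducedSet D) {j r : Fin n}
    (h : HasSub D j r) (h' : HasAdd D j r) : T ≠ .C := by
  rintro rfl
  obtain ⟨h1, h2⟩ := h
  obtain ⟨_, h4⟩ := h'
  exact hred j r h1 ⟨h2, h4⟩

/-- The conditions on a triple `(j, l, r)` under which `ε_l - ε_r` and `ε_l + ε_r` give a generator
of `𝔭₀`. Outside type `C`, the roots of row `-l` are the roots `ε_t + ε_l`. -/
structure IsTwin (D : Finset (PosRoot T n)) (j l r : Fin n) : Prop where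
  sub_mem : HasSub D j r
  add_mem : HasAdd D j r
  sub_mem_mCol : HasSub (mCol D j) l r
  add_mem_mCol : HasAdd (mCol D j) l r
  not_add : ∀ t, ¬ HasAdd D t l

/-- The uniqueness of partners, split into implications without alternatives. -/
theorem linked_facts {D : Finset (PosRoot T n)} (hD : IsOrthogonalSet D) :
    (∀ i j, HasSub D i j → Linked D i j) ∧ (∀ i j, HasAdd D i j → Linked D i j) ∧
      (∀ i j q, Linked D i j → Linked D i q → j = q) ∧
      (∀ i j p, Linked D i j → Linked D p j → i = p) ∧
      ∀ i j q, Linked D i j → Linked D j q → False := by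
  refine ⟨fun _ _ => Or.inl, fun _ _ => Or.inr, fun i j q h h' => ?_, fun i j p h h' => ?_,
    fun i j q h h' => ?_⟩
  · exact (h.unique hD h' (by simp)).2
  · exact (h.unique hD h' (by simp)).1
  · have h1 := h.unique hD h' (by simp)
    have h2 : i < j := h.elim (fun h => h.1) fun h => h.1
    exact absurd h1.1 h2.ne

theorem HasAdd.lt {S : Type*} [Membership (PosRoot T n) S] {X : S} {i j : Fin n}
    (h : HasAdd X i j) : i < j := h.1

theorem HasSub.lt {S : Type*} [Membership (PosRoot T n) S] {X : S} {i j : Fin n}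
    (h : HasSub X i j) : i < j := h.1

section
variable {D : Finset (PosRoot T n)} {j l r : Fin n}

theorem HasSub.of_mCol (hT : T ≠ .C) {t a b : Fin n} (h : HasSub (mCol D t) a b) :
    t < a ∧ a < b ∧ (HasSub D t b ∨ HasAdd D t a) := by
  rw [hasSub_mCol_iff hT] at h
  tauto

theorem HasAdd.of_mCol (hT : T ≠ .C) {t a b : Fin n} (h : HasAdd (mCol D t) a b) :
    t < a ∧ a < b ∧ (HasAdd D t b ∨ HasAdd D t a) := by
  rw [hasAdd_mCol_iff hT] at h
  tauto

theorem HasShort.of_mCol (hT : T ≠ .C) {t a : Fin n} (h : HasShort (mCol D t) a) :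
    t < a ∧ T = .B ∧ (HasShort D t ∨ HasAdd D t a) := by
  rw [hasShort_mCol_iff hT] at h
  tauto

/-! If a root of `S⁻(β)`, where `β ∈ D` is in column `t`, is in `P`, then its complement is in some
`M_p` with `p < t`; here for the decompositions `ε_t - ε_b = (ε_t - ε_a) + (ε_a - ε_b)` and
so on. -/

section
variable (hT : T ≠ .C) {t a b : Fin n}
include hT

theorem exists_of_sub_sub (h : HasSub D t b) (ha : t < a) (hab : a < b)
    (hM : ∀ q, ¬ HasSub (mCol D q) a b) : ∃ p < t, HasSub (mCol D p) t a := by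
  have := hM t
  rw [hasSub_mCol_iff hT] at this
  by_contra! hc
  tauto

theorem exists_of_add_sub (h : HasAdd D t a) (hab : a < b)
    (hM : ∀ q, ¬ HasSub (mCol D q) a b) : ∃ p < t, HasAdd (mCol D p) t b := by
  have := hM t
  rw [hasSub_mCol_iff hT] at this
  have := h.lt
  by_contra! hc
  tauto

theorem exists_of_add_add_right (h : HasAdd D t b) (ha : t < a) (hab : a < b)
    (hM : ∀ q, ¬ HasAdd (mCol D q) a b) : ∃ p < t, HasSub (mCol D p) t a := by
  have := hM t
  rw [hasAdd_mCol_iff hT] at this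
  by_contra! hc
  tauto

theorem exists_of_add_add_left (h : HasAdd D t a) (hab : a < b)
    (hM : ∀ q, ¬ HasAdd (mCol D q) a b) : ∃ p < t, HasSub (mCol D p) t b := by
  have := hM t
  rw [hasAdd_mCol_iff hT] at this
  have := h.lt
  by_contra! hc
  tauto

theorem exists_of_short (h : HasShort D t) (ha : t < a) (hB : T = .B)
    (hM : ∀ q, ¬ HasShort (mCol D q) a) : ∃ p < t, HasSub (mCol D p) t a := by
  have := hM t
  rw [hasShort_mCol_iff hT] at this
  by_contra! hc
  tauto

theorem exists_of_add_short (h : HasAdd D t a) (hB : T = .B)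
    (hM : ∀ q, ¬ HasShort (mCol D q) a) : ∃ p < t, HasShort (mCol D p) t := by
  have := hM t
  rw [hasShort_mCol_iff hT] at this
  have := h.lt
  by_contra! hc
  tauto
end

theorem IsTwin.lt_left (hT : T ≠ .C) (hz : IsTwin D j l r) : j < l :=
  (hz.sub_mem_mCol.of_mCol hT).1

section
variable (hT : T ≠ .C) (hD : IsOrthogonalSet D) (hz : IsTwin D j l r) {s i : Fin n}
include hT hD hz

/-- If `ε_r - ε_s ∈ P`, then its sum `ε_l - ε_s` with `ε_l - ε_r` is neither in `D` nor in `M`.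
In fact `ε_j + ε_r ∈ D` would put `ε_r - ε_s` into `M` if there were no `ε_t + ε_s ∈ D` with
`t < j`, which links `s` to `t`. -/
theorem IsTwin.sub_of_sub_mem (hrs : r < s) (hα : ∀ t, ¬ HasSub (mCol D t) r s) :
    ¬ HasSub D l s ∧ ∀ q, ¬ HasSub (mCol D q) l s := by
  obtain ⟨L₁, L₂, U₁, U₂, U₃⟩ := linked_facts hD
  have hjl := hz.lt_left hT
  have hlr := hz.sub_mem_mCol.lt
  have hs := hz.sub_mem
  have ha := hz.add_mem
  have hn := hz.not_add
  obtain ⟨t, htj, h1⟩ := exists_of_add_sub hT ha hrs hα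
  have h2 : HasAdd D t s := by have := h1.of_mCol hT; grind
  refine ⟨by grind, fun q hq => ?_⟩
  have h3 := hq.of_mCol hT
  have h4 : HasSub D t s := by grind
  obtain ⟨p, hp, h5⟩ := exists_of_sub_sub hT h4 (by omega) hrs hα
  have := h5.of_mCol hT
  grind

/-- If `ε_r + ε_s ∈ P`, then its sum `ε_l + ε_s` with `ε_l - ε_r` is neither in `D` nor in `M`. -/
theorem IsTwin.add_of_add_mem (hrs : r < s) (hα : ∀ t, ¬ HasAdd (mCol D t) r s) :
    ¬ HasAdd D l s ∧ ∀ q, ¬ HasAdd (mCol D q) l s := by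
  obtain ⟨L₁, L₂, U₁, U₂, U₃⟩ := linked_facts hD
  have hjl := hz.lt_left hT
  have hlr := hz.sub_mem_mCol.lt
  have hs := hz.sub_mem
  have ha := hz.add_mem
  have hn := hz.not_add
  obtain ⟨t, htj, h1⟩ := exists_of_add_add_left hT ha hrs hα
  have h2 : HasSub D t s := by have := h1.of_mCol hT; grind
  refine ⟨by grind, fun q hq => ?_⟩
  have h3 := hq.of_mCol hT
  have h4 : HasAdd D t s := by grind
  obtain ⟨p, hp, h5⟩ := exists_of_add_add_right hT h4 (by omega) hrs hα
  have := h5.of_mCol hT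
  grind

/-- If `ε_r ∈ P`, then its sum `ε_l` with `ε_l - ε_r` is neither in `D` nor in `M`. -/
theorem IsTwin.short_of_short_mem (hred : IsReducedSet D) (hB : T = .B)
    (hα : ∀ t, ¬ HasShort (mCol D t) r) :
    ¬ HasShort D l ∧ ∀ q, ¬ HasShort (mCol D q) l := by
  obtain ⟨L₁, L₂, U₁, U₂, U₃⟩ := linked_facts hD
  have V := fun p q => @HasShort.unique _ _ D hT hred p q
  have hjl := hz.lt_left hT
  have hlr := hz.sub_mem_mCol.lt
  have hs := hz.sub_mem
  have ha := hz.add_mem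
  have hn := hz.not_add
  obtain ⟨t, htj, h1⟩ := exists_of_add_short hT ha hB hα
  have h2 : HasShort D t := by have := h1.of_mCol hT; grind
  refine ⟨by grind, fun q hq => ?_⟩
  obtain ⟨p, hp, h5⟩ := exists_of_short hT h2 (by omega) hB hα
  have h6 := h5.of_mCol hT
  have := fun h => (Linked.not_hasShort hD (L₂ p t h) h2).2 rfl
  grind

/-- If `ε_i - ε_r` or `ε_i + ε_r` is in `P`, then its sum `ε_i + ε_l` with a root of the twin
`(j, l, r)` is neither in `D` nor in `M`. -/
theorem IsTwin.add_of_mem (hir : i < r)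
    (hα : (∀ t, ¬ HasSub (mCol D t) i r) ∨ ∀ t, ¬ HasAdd (mCol D t) i r) :
    (¬ HasAdd D i l ∧ ¬ HasAdd D l i) ∧
      ∀ q, ¬ HasAdd (mCol D q) i l ∧ ¬ HasAdd (mCol D q) l i := by
  obtain ⟨L₁, L₂, U₁, U₂, U₃⟩ := linked_facts hD
  have hjl := hz.lt_left hT
  have hlr := hz.sub_mem_mCol.lt
  have hs := hz.sub_mem
  have ha := hz.add_mem
  have hn := hz.not_add
  -- For `j < i` the root `ε_i ± ε_r` is in `S⁻(ε_j ± ε_r)`; being in `P`, it has its complement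
  -- `ε_j - ε_i` in an earlier set.
  have key : j < i → ∃ t < j, HasSub D t i := by
    intro hji
    have h1 : ∃ p < j, HasSub (mCol D p) j i := by
      rcases hα with hα | hα
      · exact exists_of_sub_sub hT hs hji hir hα
      · exact exists_of_add_add_right hT ha hji hir hα
    obtain ⟨p, hp, h1⟩ := h1
    have := h1.of_mCol hT
    exact ⟨p, hp, by grind⟩
  refine ⟨⟨hn i, fun h => ?_⟩, ?_⟩
  · have := h.lt
    obtain ⟨t, ht, h1⟩ := key (by omega)
    grind
  · have main : ∀ t, t < i → HasAdd D t i → False := by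
      intro t hti h
      have h1 : ∃ p < t, HasAdd (mCol D p) t r ∨ HasSub (mCol D p) t r := by
        rcases hα with hα | hα
        · obtain ⟨p, hp, h1⟩ := exists_of_add_sub hT h hir hα
          exact ⟨p, hp, Or.inl h1⟩
        · obtain ⟨p, hp, h1⟩ := exists_of_add_add_left hT h hir hα
          exact ⟨p, hp, Or.inr h1⟩
      obtain ⟨p, hp, h1⟩ := h1
      have h2 : p = j := by
        rcases h1 with h1 | h1
        · have := h1.of_mCol hT; grind
        · have := h1.of_mCol hT; grind
      obtain ⟨t', ht', h3⟩ := key (by omega)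
      grind
    intro q
    constructor
    · intro h
      have := h.of_mCol hT
      have := main q
      grind
    · intro h
      have := h.of_mCol hT
      have := main q
      grind

/-- If `ε_i - ε_l ∈ P`, adding it to both roots of the twin `(j, l, r)` gives two roots of `P` or
another twin. -/
theorem IsTwin.of_sub_mem (hil : i < l) (hα : ∀ t, ¬ HasSub (mCol D t) i l) :
    ((∀ t, ¬ HasSub (mCol D t) i r) ∧ (∀ t, ¬ HasAdd (mCol D t) i r)) ∨ IsTwin D j i r := by
  obtain ⟨L₁, L₂, U₁, U₂, U₃⟩ := linked_facts hD
  have hjl := hz.lt_left hT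
  have hlr := hz.sub_mem_mCol.lt
  have hs := hz.sub_mem
  have ha := hz.add_mem
  have hn := hz.not_add
  have hi : ∀ t, ¬ HasAdd D t i := by
    intro t h
    obtain ⟨p, hp, h1⟩ := exists_of_add_sub hT h hil hα
    have := h1.of_mCol hT
    grind
  have key : (∀ t, HasSub (mCol D t) i r → t = j) ∧ (∀ t, HasAdd (mCol D t) i r → t = j) := by
    constructor
    · intro t h; have := h.of_mCol hT; grind
    · intro t h; have := h.of_mCol hT; grind
  -- Both `ε_i - ε_r` and `ε_i + ε_r` have the complement `ε_j - ε_i`, hence they are in `M_j` under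
  -- the same condition.
  by_cases hc : j < i ∧ ∀ p < j, ¬ HasSub (mCol D p) j i
  · right
    refine ⟨hs, ha, ?_, ?_, hi⟩
    · rw [hasSub_mCol_iff hT]
      exact ⟨hc.1, hil.trans hlr, fun p hp h => hp.ne (key.1 p h), Or.inl ⟨hs, hc.2⟩⟩
    · rw [hasAdd_mCol_iff hT]
      exact ⟨hc.1, hil.trans hlr, fun p hp h => hp.ne (key.2 p h), Or.inl ⟨ha, hc.2⟩⟩
  · left
    refine ⟨fun t h => hc ?_, fun t h => hc ?_⟩
    · obtain rfl := key.1 t h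
      rw [hasSub_mCol_iff hT] at h
      grind
    · obtain rfl := key.2 t h
      rw [hasAdd_mCol_iff hT] at h
      grind

end

/-- The sum of a root of one twin and a root of another can only be `ε_l + ε_l'`, which is neither
in `D` nor in `M`. -/
theorem IsTwin.add_of_isTwin (hT : T ≠ .C) (hz : IsTwin D j l r) {j' l' s : Fin n}
    (hz' : IsTwin D j' l' s) :
    ¬ HasAdd D l l' ∧ ∀ q, ¬ HasAdd (mCol D q) l l' := by
  refine ⟨hz'.not_add l, fun q h => ?_⟩
  have := h.of_mCol hT
  have := hz.not_add q
  have := hz'.not_add q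
  tauto

/-- If `ε_j ± ε_r ∈ D`, `ε_l - ε_r ∈ M_j`, and row `-l` is occupied by `ε_i + ε_l ∈ D`, then row
`-i` is free, and `(j, i, r)` is a twin. -/
theorem isTwin_of_add_mem (hT : T ≠ .C) (hD : IsOrthogonalSet D) {i : Fin n}
    (hs : HasSub D j r) (ha : HasAdd D j r)
    (h1 : HasSub (mCol D j) l r) (hil : HasAdd D i l) : IsTwin D j i r := by
  obtain ⟨L₁, L₂, U₁, U₂, U₃⟩ := linked_facts hD
  have hjl := (h1.of_mCol hT).1
  have hlr := h1.lt
  have hlt := hil.lt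
  have key : (∀ t, HasSub (mCol D t) i r → t = j) ∧ (∀ t, HasAdd (mCol D t) i r → t = j) := by
    constructor
    · intro t h; have := h.of_mCol hT; grind
    · intro t h; have := h.of_mCol hT; grind
  have hji : j < i := by
    by_contra hji
    have hne : i < j := lt_of_le_of_ne (not_lt.1 hji) (by grind)
    have h3 : ∀ p < i, ¬ HasAdd (mCol D p) i r := fun p hp h => by
      have := key.2 p h; omega
    rw [hasSub_mCol_iff hT] at h1
    refine h1.2.2.1 i hne ?_
    rw [hasSub_mCol_iff hT]
    exact ⟨hlt, hlr, fun p hp => h1.2.2.1 p (hp.trans hne), Or.inr ⟨hil, h3⟩⟩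
  have hc : ∀ p < j, ¬ HasSub (mCol D p) j i := fun p hp h => by
    have := h.of_mCol hT
    grind
  refine ⟨hs, ha, ?_, ?_, by grind⟩
  · rw [hasSub_mCol_iff hT]
    exact ⟨hji, hlt.trans hlr, fun p hp h => hp.ne (key.1 p h), Or.inl ⟨hs, hc⟩⟩
  · rw [hasAdd_mCol_iff hT]
    exact ⟨hji, hlt.trans hlr, fun p hp h => hp.ne (key.2 p h), Or.inl ⟨ha, hc⟩⟩

end

end Combinatorics

section Brackets
variable {T : ClassicalType} {n : ℕ} {k : Type*} [Field k]

/-! ### Brackets of root vectors -/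

theorem lie_rootMatrix_sub_sub {i j l : Fin n} (h : i < j) (h' : j < l) :
    ⁅rootMatrix k (sub i j h : PosRoot T n), rootMatrix k (sub j l h' : PosRoot T n)⁆ =
      - rootMatrix k (sub i l (h.trans h')) := by
  have := (h.trans h').ne
  have := (h.trans h').ne'
  simp [rootMatrix, Ring.lie_def, mul_sub, sub_mul, *]

theorem lie_rootMatrix_sub_add (hT : T ≠ .C) {i j l : Fin n} (h : i < j) (h' : j < l) :
    ⁅rootMatrix k (sub i j h : PosRoot T n), rootMatrix k (add j l h' : PosRoot T n)⁆ =
      - rootMatrix k (add i l (h.trans h')) := by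
  have := (h.trans h').ne
  have := (h.trans h').ne'
  have := h'.ne
  have := h'.ne'
  cases T with
  | B => simp [rootMatrix, Ring.lie_def, mul_sub, sub_mul, *]
  | D => simp [rootMatrix, Ring.lie_def, mul_sub, sub_mul, *]
  | C => exact absurd rfl hT

theorem lie_rootMatrix_sub_add_right (hT : T ≠ .C) {i j l : Fin n} (h : i < l) (h' : j < l)
    (hij : i < j) :
    ⁅rootMatrix k (sub i l h : PosRoot T n), rootMatrix k (add j l h' : PosRoot T n)⁆ =
      rootMatrix k (add i j hij) := by
  have := h.ne
  have := h.ne'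
  have := h'.ne
  have := h'.ne'
  cases T with
  | B => simp [rootMatrix, Ring.lie_def, mul_sub, sub_mul, *]; abel
  | D => simp [rootMatrix, Ring.lie_def, mul_sub, sub_mul, *]; abel
  | C => exact absurd rfl hT

theorem lie_rootMatrix_add_sub_right (hT : T ≠ .C) {i j l : Fin n} (h : i < l) (h' : j < l)
    (hij : i < j) :
    ⁅rootMatrix k (add i l h : PosRoot T n), rootMatrix k (sub j l h' : PosRoot T n)⁆ =
      rootMatrix k (add i j hij) := by
  have := h.ne
  have := h.ne'
  have := h'.ne
  have := h'.ne'
  cases T with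
  | B => simp [rootMatrix, Ring.lie_def, mul_sub, sub_mul, *]; abel
  | D => simp [rootMatrix, Ring.lie_def, mul_sub, sub_mul, *]; abel
  | C => exact absurd rfl hT

/-- The structure constant is `±1`, except for `(ε_i + ε_j) + (ε_i - ε_j) = 2ε_i`, where it is
`2`. -/
theorem lie_rootMatrix_eq_smul (hk : (2 : k) ≠ 0 ∨ n ≤ 1) {σ α β : PosRoot T n}
    (h : Splits σ α β) :
    ∃ c : k, c ≠ 0 ∧ ⁅rootMatrix k α, rootMatrix k β⁆ = c • rootMatrix k σ := by
  rcases α with ⟨i, j, hij⟩ | ⟨i, j, hij⟩ | i | i <;>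
  rcases β with ⟨p, q, hpq⟩ | ⟨p, q, hpq⟩ | p | p <;>
  rcases σ with ⟨r, s, hrs⟩ | ⟨r, s, hrs⟩ | r | r <;>
  simp only [Splits] at h
  · obtain ⟨rfl, rfl, rfl⟩ := h
    exact ⟨-1, by simp, by simp [lie_rootMatrix_sub_sub hij hpq]⟩
  · obtain ⟨rfl, ⟨rfl, rfl⟩ | ⟨rfl, rfl⟩⟩ := h
    · have := hrs.ne
      have := hrs.ne'
      have := hpq.ne
      have := hpq.ne'
      refine ⟨-1, by simp, ?_⟩
      cases T with
      | C => simp [rootMatrix, Ring.lie_def, mul_sub, sub_mul, mul_add, add_mul, *]; abel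
      | B => simp [rootMatrix, Ring.lie_def, mul_sub, sub_mul, *]
      | D => simp [rootMatrix, Ring.lie_def, mul_sub, sub_mul, *]
    · have := hij.ne
      have := hij.ne'
      have := hpq.ne
      have := hpq.ne'
      refine ⟨if T = .C then -1 else 1, by split_ifs <;> simp, ?_⟩
      cases T with
      | C => simp [rootMatrix, Ring.lie_def, mul_sub, sub_mul, mul_add, add_mul, *]; abel
      | B => simp [rootMatrix, Ring.lie_def, mul_sub, sub_mul, *]; abel
      | D => simp [rootMatrix, Ring.lie_def, mul_sub, sub_mul, *]; abel
  · obtain ⟨rfl, rfl⟩ := h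
    exact ⟨-1, by simp, by simp [rootMatrix, Ring.lie_def, mul_sub, sub_mul]⟩
  · obtain ⟨rfl, rfl, rfl⟩ := h
    exact ⟨-1, by simp, by simp [rootMatrix, Ring.lie_def, mul_sub, sub_mul]; abel⟩
  · obtain ⟨rfl, rfl, rfl⟩ := h
    have := hij.ne
    have := hij.ne'
    have := hpq.ne
    have := hpq.ne'
    have := hrs.ne
    have := hrs.ne'
    cases T with
    | C =>
      exact ⟨1, by simp, by
        simp [rootMatrix, Ring.lie_def, mul_sub, sub_mul, mul_add, add_mul, *]; abel⟩
    | B => exact ⟨1, by simp, by simp [rootMatrix, Ring.lie_def, mul_sub, sub_mul, *]; abel⟩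
    | D => exact ⟨1, by simp, by simp [rootMatrix, Ring.lie_def, mul_sub, sub_mul, *]; abel⟩
  · obtain ⟨rfl, rfl, rfl⟩ := h
    -- There are two indices `i < j`, so that `n ≤ 1` is impossible.
    have h2 : (2 : k) ≠ 0 := hk.resolve_right (by omega)
    have := hij.ne
    have := hij.ne'
    refine ⟨2, h2, ?_⟩
    simp [rootMatrix, Ring.lie_def, mul_sub, sub_mul, mul_add, add_mul, *, two_smul]
  · obtain ⟨rfl, rfl⟩ := h
    have := hrs.ne
    have := hrs.ne'
    exact ⟨1, by simp, by simp [rootMatrix, Ring.lie_def, mul_sub, sub_mul]; abel⟩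

theorem lie_rootMatrix_eq_zero {α β : PosRoot T n} (h : ∀ σ, ¬ Splits σ α β)
    (h' : ∀ σ, ¬ Splits σ β α) : ⁅rootMatrix k α, rootMatrix k β⁆ = 0 := by
  have key : ∀ (i j p q : Fin n) (hij : i < j) (hpq : p < q),
      (∀ σ : PosRoot T n, ¬ Splits σ (sub i j hij) (add p q hpq)) →
      (∀ σ : PosRoot T n, ¬ Splits σ (add p q hpq) (sub i j hij)) →
      ⁅rootMatrix k (sub i j hij : PosRoot T n),
        rootMatrix k (add p q hpq : PosRoot T n)⁆ = 0 := by
    intro i j p q hij hpq h h'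
    have e1 : j ≠ p := by
      rintro rfl
      exact h (add i q (hij.trans hpq)) (by simp [Splits])
    have e2 : j = q → i = p := by
      rintro rfl
      rcases lt_trichotomy i p with h1 | h1 | h1
      · exact (h (add i p h1) (by simp [Splits])).elim
      · exact h1
      · exact (h' (add p i h1) (by simp [Splits])).elim
    cases T with
    | C =>
      have e3 : j ≠ q := by
        rintro rfl
        obtain rfl := e2 rfl
        exact h' (long i) (by simp [Splits])
      simp [rootMatrix, Ring.lie_def, mul_sub, sub_mul, mul_add, add_mul, e1, e1.symm, e3, e3.symm]
    | B =>
      by_cases e : j = q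
      · obtain rfl := e2 e
        subst e
        simp [rootMatrix, Ring.lie_def, mul_sub, sub_mul, e1, e1.symm]
      · simp [rootMatrix, Ring.lie_def, mul_sub, sub_mul, e1, e1.symm, e, Ne.symm e]
    | D =>
      by_cases e : j = q
      · obtain rfl := e2 e
        subst e
        simp [rootMatrix, Ring.lie_def, mul_sub, sub_mul, e1, e1.symm]
      · simp [rootMatrix, Ring.lie_def, mul_sub, sub_mul, e1, e1.symm, e, Ne.symm e]
  rcases α with ⟨i, j, hij⟩ | ⟨i, j, hij⟩ | i | i <;>
  rcases β with ⟨p, q, hpq⟩ | ⟨p, q, hpq⟩ | p | p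
  · have e1 : i ≠ q := by
      rintro rfl
      exact h' (sub p j (by order)) (by simp [Splits])
    have e2 : j ≠ p := by
      rintro rfl
      exact h (sub i q (by order)) (by simp [Splits])
    simp [rootMatrix, Ring.lie_def, mul_sub, sub_mul, e1, e2, e1.symm, e2.symm]
  · exact key _ _ _ _ _ _ h h'
  · have e2 : j ≠ p := by
      rintro rfl
      exact h (short i) (by simp [Splits])
    simp [rootMatrix, Ring.lie_def, mul_sub, sub_mul, e2, e2.symm]
  · have e2 : j ≠ p := by
      rintro rfl
      exact h (add i j hij) (by simp [Splits])
    simp [rootMatrix, Ring.lie_def, mul_sub, sub_mul, e2, e2.symm]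
  · rw [← lie_skew, key _ _ _ _ _ _ h' h, neg_zero]
  · cases T <;> simp [rootMatrix, Ring.lie_def, mul_sub, sub_mul, mul_add, add_mul]
  · simp [rootMatrix, Ring.lie_def, mul_sub, sub_mul]
  · simp [rootMatrix, Ring.lie_def, mul_add, add_mul]
  · have e2 : q ≠ i := by
      rintro rfl
      exact h' (short p) (by simp [Splits])
    simp [rootMatrix, Ring.lie_def, mul_sub, sub_mul, e2, e2.symm]
  · simp [rootMatrix, Ring.lie_def, mul_sub, sub_mul]
  · rcases lt_trichotomy i p with h1 | h1 | h1
    · exact (h (add i p h1) (by simp [Splits])).elim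
    · rw [h1, lie_self]
    · exact (h' (add p i h1) (by simp [Splits])).elim
  · have e2 : q ≠ i := by
      rintro rfl
      exact h' (add p q hpq) (by simp [Splits])
    simp [rootMatrix, Ring.lie_def, mul_sub, sub_mul, e2, e2.symm]
  · simp [rootMatrix, Ring.lie_def, mul_add, add_mul]
  · simp [rootMatrix, Ring.lie_def]

theorem lie_rootVec_eq_smul (hk : (2 : k) ≠ 0 ∨ n ≤ 1) {σ α β : PosRoot T n}
    (h : Splits σ α β) : ∃ c : k, c ≠ 0 ∧ ⁅rootVec k α, rootVec k β⁆ = c • rootVec k σ := by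
  obtain ⟨c, hc, h1⟩ := lie_rootMatrix_eq_smul hk h
  exact ⟨c, hc, Subtype.ext h1⟩

theorem lie_rootVec_eq_zero {α β : PosRoot T n} (h : ∀ σ, ¬ Splits σ α β)
    (h' : ∀ σ, ¬ Splits σ β α) : ⁅rootVec k α, rootVec k β⁆ = 0 :=
  Subtype.ext (lie_rootMatrix_eq_zero h h')

theorem lie_rootVec_cases (hk : (2 : k) ≠ 0 ∨ n ≤ 1) (α β : PosRoot T n) :
    ⁅rootVec k α, rootVec k β⁆ = 0 ∨
      ∃ σ, (Splits σ α β ∨ Splits σ β α) ∧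
        ∃ c : k, ⁅rootVec k α, rootVec k β⁆ = c • rootVec k σ := by
  by_cases h : ∀ σ, ¬ Splits σ α β
  · by_cases h' : ∀ σ, ¬ Splits σ β α
    · exact Or.inl (lie_rootVec_eq_zero h h')
    · push Not at h'
      obtain ⟨σ, h'⟩ := h'
      obtain ⟨c, -, h1⟩ := lie_rootVec_eq_smul hk h'
      exact Or.inr ⟨σ, Or.inr h', -c, by rw [← lie_skew, h1, neg_smul]⟩
  · push Not at h
    obtain ⟨σ, h⟩ := h
    obtain ⟨c, -, h1⟩ := lie_rootVec_eq_smul hk h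
    exact Or.inr ⟨σ, Or.inl h, c, h1⟩

theorem lie_rootVec_sub_sub {i j l : Fin n} (h : i < j) (h' : j < l) :
    ⁅rootVec k (sub i j h : PosRoot T n), rootVec k (sub j l h' : PosRoot T n)⁆ =
      - rootVec k (sub i l (h.trans h') : PosRoot T n) :=
  Subtype.ext (lie_rootMatrix_sub_sub h h')

theorem lie_rootVec_sub_add (hT : T ≠ .C) {i j l : Fin n} (h : i < j) (h' : j < l) :
    ⁅rootVec k (sub i j h : PosRoot T n), rootVec k (add j l h' : PosRoot T n)⁆ =
      - rootVec k (add i l (h.trans h') : PosRoot T n) :=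
  Subtype.ext (lie_rootMatrix_sub_add hT h h')

theorem lie_rootVec_sub_add_right (hT : T ≠ .C) {i j l : Fin n} (h : i < l) (h' : j < l)
    (hij : i < j) :
    ⁅rootVec k (sub i l h : PosRoot T n), rootVec k (add j l h' : PosRoot T n)⁆ =
      rootVec k (add i j hij : PosRoot T n) :=
  Subtype.ext (lie_rootMatrix_sub_add_right hT h h' hij)

theorem lie_rootVec_add_sub_right (hT : T ≠ .C) {i j l : Fin n} (h : i < l) (h' : j < l)
    (hij : i < j) :
    ⁅rootVec k (add i l h : PosRoot T n), rootVec k (sub j l h' : PosRoot T n)⁆ =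
      rootVec k (add i j hij : PosRoot T n) :=
  Subtype.ext (lie_rootMatrix_add_sub_right hT h h' hij)

theorem canonicalForm_rootVec (D : Finset (PosRoot T n)) (ξ : PosRoot T n → k) (α : PosRoot T n) :
    canonicalForm D ξ (rootVec k α) = if α ∈ D then ξ α else 0 := by
  simp [canonicalForm, dualVec_rootVec]

section
variable {D : Finset (PosRoot T n)} {ξ : PosRoot T n → k}

theorem exists_of_canonicalForm_lie_ne_zero (hk : (2 : k) ≠ 0 ∨ n ≤ 1) {α β : PosRoot T n}
    (h : canonicalForm D ξ ⁅rootVec k α, rootVec k β⁆ ≠ 0) :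
    ∃ σ ∈ D, Splits σ α β ∨ Splits σ β α := by
  rcases lie_rootVec_cases hk α β with h0 | ⟨σ, hσ, c, hc⟩
  · simp [h0] at h
  · refine ⟨σ, ?_, hσ⟩
    by_contra hn
    simp [hc, canonicalForm_rootVec, hn] at h

theorem canonicalForm_lie_ne_zero (hk : (2 : k) ≠ 0 ∨ n ≤ 1) (hξ : ∀ β ∈ D, ξ β ≠ 0)
    {σ α β : PosRoot T n} (h : Splits σ α β) (hσ : σ ∈ D) :
    canonicalForm D ξ ⁅rootVec k α, rootVec k β⁆ ≠ 0 := by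
  obtain ⟨c, hc, h1⟩ := lie_rootVec_eq_smul hk h
  simp [h1, canonicalForm_rootVec, hσ, hc, hξ σ hσ]

end

end Brackets

section Polarization
variable {T : ClassicalType} {n : ℕ} {k : Type*} [Field k]
  {D : Finset (PosRoot T n)} {ξ : PosRoot T n → k}

/-! ### `𝔭` is an isotropic subalgebra -/

/-- The generator of `𝔭₀` belonging to the triple `(j, l, r)`. -/
def twinVec (ξ : PosRoot T n → k) {j l r : Fin n} (hjl : j < l) (hlr : l < r) : nilAlg k T n :=
  ξ (add j r (hjl.trans hlr)) • rootVec k (sub l r hlr) -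
    ξ (sub j r (hjl.trans hlr)) • rootVec k (add l r hlr)

theorem row_ne_neg_iff (hT : T ≠ .C) {l : Fin n} :
    (∀ β ∈ D, β.row ≠ MIdx.neg l) ↔ ∀ t, ¬ HasAdd D t l := by
  constructor
  · rintro h t ⟨h1, h2⟩
    exact h _ h2 rfl
  · intro h β hβ hr
    cases β <;> simp only [row, MIdx.neg.injEq, reduceCtorEq] at hr
    · subst hr
      exact h _ ⟨_, hβ⟩
    · exact hT rfl

theorem pSpace_eq_span (hred : IsReducedSet D) :
    pSpace D ξ = Submodule.span k (rootVec k '' pSet D ∪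
      {x | ∃ (j l r : Fin n) (hjl : j < l) (hlr : l < r), IsTwin D j l r ∧
        x = twinVec ξ hjl hlr}) := by
  rw [Submodule.span_union, pSpace, pZero]
  congr 2
  ext x
  constructor
  · rintro ⟨j, l, r, hjl, hlr, h1, h2, h3, h4, h5, rfl⟩
    have hT := ne_C_of_pair hred ⟨_, h1⟩ ⟨_, h2⟩
    exact ⟨j, l, r, hjl, hlr, ⟨⟨_, h1⟩, ⟨_, h2⟩, ⟨_, h3⟩, ⟨_, h4⟩, (row_ne_neg_iff hT).1 h5⟩, rfl⟩
  · rintro ⟨j, l, r, hjl, hlr, ⟨⟨_, h1⟩, ⟨_, h2⟩, ⟨_, h3⟩, ⟨_, h4⟩, h5⟩, rfl⟩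
    have hT := ne_C_of_pair hred ⟨_, h1⟩ ⟨_, h2⟩
    exact ⟨j, l, r, hjl, hlr, h1, h2, h3, h4, (row_ne_neg_iff hT).2 h5, rfl⟩

theorem rootVec_mem_pSpace {α : PosRoot T n} (hα : α ∈ pSet D) : rootVec k α ∈ pSpace D ξ :=
  Submodule.mem_sup_left (Submodule.subset_span ⟨α, hα, rfl⟩)

theorem IsTwin.ne_C (hred : IsReducedSet D) {j l r : Fin n} (hz : IsTwin D j l r) : T ≠ .C :=
  ne_C_of_pair hred hz.sub_mem hz.add_mem

theorem IsTwin.twinVec_mem (hred : IsReducedSet D) {j l r : Fin n} (hz : IsTwin D j l r)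
    (hjl : j < l) (hlr : l < r) :
    twinVec ξ hjl hlr ∈ pSpace D ξ := by
  rw [pSpace_eq_span hred]
  exact Submodule.subset_span (Or.inr ⟨j, l, r, hjl, hlr, hz, rfl⟩)

theorem not_hasSub_of_mem_pSet {i j : Fin n} {h : i < j} (hα : sub i j h ∈ pSet D) (t : Fin n) :
    ¬ HasSub (mCol D t) i j := fun h' => hα t h'.2

theorem not_hasAdd_of_mem_pSet {i j : Fin n} {h : i < j} (hα : add i j h ∈ pSet D) (t : Fin n) :
    ¬ HasAdd (mCol D t) i j := fun h' => hα t h'.2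

/-- The sum of `α ∈ P` and a root `ε_l ± ε_r` of a twin is in `P` and not in `D`, unless
`α = ε_i - ε_l`. -/
theorem IsTwin.splits (hred : IsReducedSet D) (hD : IsOrthogonalSet D) {j l r : Fin n}
    (hz : IsTwin D j l r) (hlr : l < r) {α z σ : PosRoot T n} (hα : α ∈ pSet D)
    (hzz : z = sub l r hlr ∨ z = add l r hlr) (h : Splits σ α z ∨ Splits σ z α) :
    (∃ (i : Fin n) (h : i < l), α = sub i l h) ∨ σ ∉ D ∧ σ ∈ pSet D := by
  have hT := hz.ne_C hred
  have R₂ := fun s hrs hα => @IsTwin.sub_of_sub_mem _ _ D _ _ _ hT hD hz s hrs hα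
  have R₃ := fun s hrs hα => @IsTwin.add_of_add_mem _ _ D _ _ _ hT hD hz s hrs hα
  have R₄ := fun i hir hα => @IsTwin.add_of_mem _ _ D _ _ _ hT hD hz i hir hα
  rcases α with ⟨p, q, hpq⟩ | ⟨p, q, hpq⟩ | p | p
  · have h1 := not_hasSub_of_mem_pSet hα
    by_cases hq : q = l
    · subst hq
      exact Or.inl ⟨_, _, rfl⟩
    · right
      rcases σ with ⟨a, b, hab⟩ | ⟨a, b, hab⟩ | a | a <;> rcases hzz with rfl | rfl <;>
      simp only [Splits, or_false, false_or] at h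
      · rcases h with ⟨rfl, rfl, rfl⟩ | ⟨rfl, rfl, rfl⟩
        · exact absurd rfl hq
        · exact ⟨fun h => (R₂ _ hpq h1).1 ⟨_, h⟩, fun t h => (R₂ _ hpq h1).2 t ⟨_, h⟩⟩
      · have hqr : q = r := by grind
        subst hqr
        have R := R₄ _ hpq (Or.inl h1)
        rcases h with ⟨rfl, ⟨h2, rfl⟩ | ⟨rfl, h3⟩⟩ | ⟨rfl, rfl, -⟩
        · exact absurd h2.symm hq
        · exact ⟨fun h => R.1.1 ⟨_, h⟩, fun t h => (R.2 t).1 ⟨_, h⟩⟩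
        · exact ⟨fun h => R.1.2 ⟨_, h⟩, fun t h => (R.2 t).2 ⟨_, h⟩⟩
      · exact absurd rfl hT
  · have h1 := not_hasAdd_of_mem_pSet hα
    right
    rcases σ with ⟨a, b, hab⟩ | ⟨a, b, hab⟩ | a | a <;> rcases hzz with rfl | rfl <;>
      simp only [Splits, or_false] at h
    · rcases h with ⟨rfl, rfl, rfl⟩ | ⟨rfl, ⟨rfl, rfl⟩ | ⟨rfl, rfl⟩⟩
      · have R := R₄ _ hpq (Or.inr h1)
        exact ⟨fun h => R.1.1 ⟨_, h⟩, fun t h => (R.2 t).1 ⟨_, h⟩⟩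
      · exact ⟨fun h => (R₃ _ hpq h1).1 ⟨_, h⟩, fun t h => (R₃ _ hpq h1).2 t ⟨_, h⟩⟩
      · have R := R₄ _ hpq (Or.inr h1)
        exact ⟨fun h => R.1.2 ⟨_, h⟩, fun t h => (R.2 t).2 ⟨_, h⟩⟩
    · exact absurd rfl hT
  · right
    rcases σ with ⟨a, b, hab⟩ | ⟨a, b, hab⟩ | a | a <;> rcases hzz with rfl | rfl <;>
      simp only [Splits, or_false, false_or] at h
    obtain ⟨rfl, rfl⟩ := h
    have R := IsTwin.short_of_short_mem hT hD hz hred rfl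
      (fun t => by rw [hasShort_iff]; exact hα t)
    simp only [hasShort_iff] at R
    exact R
  · exact absurd rfl hT

theorem IsTwin.splits_twin (hred : IsReducedSet D) (hD : IsOrthogonalSet D)
    {j l r j' l' r' : Fin n} (hz : IsTwin D j l r) (hlr : l < r) (hz' : IsTwin D j' l' r')
    (hlr' : l' < r') {z z' σ : PosRoot T n} (hzz : z = sub l r hlr ∨ z = add l r hlr)
    (hzz' : z' = sub l' r' hlr' ∨ z' = add l' r' hlr')
    (h : Splits σ z z') : σ ∉ D ∧ σ ∈ pSet D := by
  have hT := hz.ne_C hred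
  have h1 : l' ≠ r := fun h => hz'.not_add _ (h ▸ hz.add_mem)
  have h2 : l ≠ r' := fun h => hz.not_add _ (h ▸ hz'.add_mem)
  have R := IsTwin.add_of_isTwin hT hz hz'
  rcases σ with ⟨a, b, hab⟩ | ⟨a, b, hab⟩ | a | a <;> rcases hzz with rfl | rfl <;>
    rcases hzz' with rfl | rfl <;> simp only [Splits] at h
  · exact absurd h.2.1 h1
  · obtain ⟨rfl, ⟨h3, -⟩ | ⟨rfl, rfl⟩⟩ := h
    · exact absurd h3 h1
    · exact ⟨fun h => R.1 ⟨_, h⟩, fun t h => R.2 t ⟨_, h⟩⟩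
  · obtain ⟨rfl, rfl, rfl⟩ := h
    exact ⟨fun h => R.1 ⟨_, h⟩, fun t h => R.2 t ⟨_, h⟩⟩
  · exact absurd rfl hT

theorem lie_mem_span (hk : (2 : k) ≠ 0 ∨ n ≤ 1) {α β : PosRoot T n}
    (p : Submodule k (nilAlg k T n))
    (h : ∀ σ, Splits σ α β ∨ Splits σ β α → rootVec k σ ∈ p) :
    ⁅rootVec k α, rootVec k β⁆ ∈ p := by
  rcases lie_rootVec_cases hk α β with h0 | ⟨σ, hσ, c, hc⟩
  · rw [h0]; exact p.zero_mem
  · rw [hc]; exact p.smul_mem _ (h σ hσ)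

theorem lie_sub_twinVec (hT : T ≠ .C) {i j l r : Fin n} (hil : i < l) (hjl : j < l) (hlr : l < r) :
    ⁅rootVec k (sub i l hil : PosRoot T n), twinVec ξ hjl hlr⁆ =
      ξ (sub j r (hjl.trans hlr)) • rootVec k (add i r (hil.trans hlr)) -
        ξ (add j r (hjl.trans hlr)) • rootVec k (sub i r (hil.trans hlr)) := by
  rw [twinVec, lie_sub, lie_smul, lie_smul, lie_rootVec_sub_sub hil hlr,
    lie_rootVec_sub_add hT hil hlr]
  module

theorem lie_rootVec_twinVec_mem (hk : (2 : k) ≠ 0 ∨ n ≤ 1) (hred : IsReducedSet D)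
    (hD : IsOrthogonalSet D) {j l r : Fin n} (hz : IsTwin D j l r) (hjl : j < l) (hlr : l < r)
    {α : PosRoot T n} (hα : α ∈ pSet D) :
    ⁅rootVec k α, twinVec ξ hjl hlr⁆ ∈ pSpace D ξ ∧
      canonicalForm D ξ ⁅rootVec k α, twinVec ξ hjl hlr⁆ = 0 := by
  have hT := hz.ne_C hred
  by_cases hα' : ∃ (i : Fin n) (h : i < l), α = sub i l h
  · obtain ⟨i, hil, rfl⟩ := hα'
    rw [lie_sub_twinVec hT]
    constructor
    · rcases IsTwin.of_sub_mem hT hD hz hil (not_hasSub_of_mem_pSet hα) with h | h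
      · exact Submodule.sub_mem _
          (Submodule.smul_mem _ _ (rootVec_mem_pSpace fun t h' => h.2 t ⟨_, h'⟩))
          (Submodule.smul_mem _ _ (rootVec_mem_pSpace fun t h' => h.1 t ⟨_, h'⟩))
      · rw [← neg_sub]
        exact Submodule.neg_mem _ (h.twinVec_mem hred (h.lt_left hT) (hil.trans hlr))
    · simp only [map_sub, map_smul, canonicalForm_rootVec, smul_eq_mul]
      obtain ⟨L₁, L₂, U₁, U₂, U₃⟩ := linked_facts hD
      by_cases hij : i = j
      · subst hij
        rw [if_pos hz.add_mem.2, if_pos hz.sub_mem.2]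
        ring
      · have h0 := L₁ _ _ hz.sub_mem
        rw [if_neg fun h => hij (U₂ _ _ _ (L₂ _ _ ⟨_, h⟩) h0),
          if_neg fun h => hij (U₂ _ _ _ (L₁ _ _ ⟨_, h⟩) h0)]
        simp
  · have key : ∀ z : PosRoot T n, z = sub l r hlr ∨ z = add l r hlr →
        ∀ σ, Splits σ α z ∨ Splits σ z α →
        σ ∉ D ∧ σ ∈ pSet D := fun z hzz σ h =>
      (hz.splits hred hD hlr hα hzz h).resolve_left hα'
    have h1 : ∀ z : PosRoot T n, z = sub l r hlr ∨ z = add l r hlr →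
        ⁅rootVec k α, rootVec k z⁆ ∈ pSpace D ξ ⊓ LinearMap.ker (canonicalForm D ξ) :=
      fun z hzz => lie_mem_span hk _ fun σ hσ => ⟨rootVec_mem_pSpace (key z hzz σ hσ).2, by
        simp [canonicalForm_rootVec, (key z hzz σ hσ).1]⟩
    have h2 : ⁅rootVec k α, twinVec ξ hjl hlr⁆ ∈
        pSpace D ξ ⊓ LinearMap.ker (canonicalForm D ξ) := by
      rw [twinVec, lie_sub, lie_smul, lie_smul]
      exact Submodule.sub_mem _ (Submodule.smul_mem _ _ (h1 _ (Or.inl rfl)))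
        (Submodule.smul_mem _ _ (h1 _ (Or.inr rfl)))
    exact h2

theorem lie_twinVec_twinVec_mem (hk : (2 : k) ≠ 0 ∨ n ≤ 1) (hred : IsReducedSet D)
    (hD : IsOrthogonalSet D) {j l r j' l' r' : Fin n} (hz : IsTwin D j l r) (hjl : j < l)
    (hlr : l < r) (hz' : IsTwin D j' l' r') (hjl' : j' < l') (hlr' : l' < r') :
    ⁅twinVec ξ hjl hlr, twinVec ξ hjl' hlr'⁆ ∈
      pSpace D ξ ⊓ LinearMap.ker (canonicalForm D ξ) := by
  have h1 : ∀ z : PosRoot T n, z = sub l r hlr ∨ z = add l r hlr →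
      ∀ z' : PosRoot T n, z' = sub l' r' hlr' ∨ z' = add l' r' hlr' →
      ⁅rootVec k z, rootVec k z'⁆ ∈
        pSpace D ξ ⊓ LinearMap.ker (canonicalForm D ξ) := by
    intro z hzz z' hzz'
    refine lie_mem_span hk _ fun σ hσ => ?_
    have h := hσ.elim (hz.splits_twin hred hD hlr hz' hlr' hzz hzz')
      (hz'.splits_twin hred hD hlr' hz hlr hzz' hzz)
    exact ⟨rootVec_mem_pSpace h.2, by simp [canonicalForm_rootVec, h.1]⟩
  have h2 : ∀ z : PosRoot T n, z = sub l r hlr ∨ z = add l r hlr →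
      ⁅rootVec k z, twinVec ξ hjl' hlr'⁆ ∈
        pSpace D ξ ⊓ LinearMap.ker (canonicalForm D ξ) := by
    intro z hzz
    rw [twinVec, lie_sub, lie_smul, lie_smul]
    exact Submodule.sub_mem _ (Submodule.smul_mem _ _ (h1 z hzz _ (Or.inl rfl)))
      (Submodule.smul_mem _ _ (h1 z hzz _ (Or.inr rfl)))
  rw [twinVec, sub_lie, smul_lie, smul_lie]
  exact Submodule.sub_mem _ (Submodule.smul_mem _ _ (h2 _ (Or.inl rfl)))
      (Submodule.smul_mem _ _ (h2 _ (Or.inr rfl)))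

theorem lie_rootVec_rootVec_mem (hk : (2 : k) ≠ 0 ∨ n ≤ 1) {α β : PosRoot T n}
    (hα : α ∈ pSet D) (hβ : β ∈ pSet D) :
    ⁅rootVec k α, rootVec k β⁆ ∈ pSpace D ξ ⊓ LinearMap.ker (canonicalForm D ξ) := by
  have key : ∀ {σ α β : PosRoot T n}, α ∈ pSet D → β ∈ pSet D → Splits σ α β → σ ∉ D := by
    intro σ α β hα hβ h hσ
    obtain ⟨l, -, hl⟩ := h.exists_mem_mCol hσ hβ
    exact hα l hl
  refine lie_mem_span hk _ fun σ hσ => ⟨rootVec_mem_pSpace ?_, ?_⟩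
  · exact hσ.elim (fun h => mem_pSet_of_splits h hα hβ) fun h => mem_pSet_of_splits h hβ hα
  · have : σ ∉ D := hσ.elim (key hα hβ) (key hβ hα)
    simp [canonicalForm_rootVec, this]

/-- The subspace `𝔭` is a subalgebra, and it is isotropic for `f`. -/
theorem lie_mem_pSpace_inf_ker (hk : (2 : k) ≠ 0 ∨ n ≤ 1) (hred : IsReducedSet D)
    (hD : IsOrthogonalSet D) {x y : nilAlg k T n} (hx : x ∈ pSpace D ξ) (hy : y ∈ pSpace D ξ) :
    ⁅x, y⁆ ∈ pSpace D ξ ⊓ LinearMap.ker (canonicalForm D ξ) := by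
  rw [pSpace_eq_span hred] at hx hy
  induction hx, hy using Submodule.span_induction₂ with
  | mem_mem x y hx hy =>
    rcases hx with ⟨α, hα, rfl⟩ | ⟨j, l, r, hjl, hlr, hz, rfl⟩ <;>
    rcases hy with ⟨β, hβ, rfl⟩ | ⟨j', l', r', hjl', hlr', hz', rfl⟩
    · exact lie_rootVec_rootVec_mem hk hα hβ
    · exact lie_rootVec_twinVec_mem hk hred hD hz' hjl' hlr' hα
    · rw [← lie_skew]
      exact Submodule.neg_mem _ (lie_rootVec_twinVec_mem hk hred hD hz hjl hlr hβ)
    · exact lie_twinVec_twinVec_mem hk hred hD hz hjl hlr hz' hjl' hlr'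
  | zero_left => rw [zero_lie]; exact Submodule.zero_mem _
  | zero_right => rw [lie_zero]; exact Submodule.zero_mem _
  | add_left x y z _ _ _ h1 h2 => rw [add_lie]; exact Submodule.add_mem _ h1 h2
  | add_right x y z _ _ _ h1 h2 => rw [lie_add]; exact Submodule.add_mem _ h1 h2
  | smul_left r x y _ _ h => rw [smul_lie]; exact Submodule.smul_mem _ _ h
  | smul_right r x y _ _ h => rw [lie_smul]; exact Submodule.smul_mem _ _ h

/-! ### `𝔭` is maximal isotropic -/

/-- A positive root is determined by its row and column. -/
theorem position_injective :
    Function.Injective fun α : PosRoot T n => (α.row, α.col) := by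
  intro α β h
  have := rootMatrix_apply ℚ α β
  simp only [Prod.mk.injEq] at h
  rw [h.1, h.2, rootMatrix_apply, if_pos rfl] at this
  by_contra hne
  simp [Ne.symm hne] at this

noncomputable instance : Fintype (PosRoot T n) :=
  haveI := Finite.of_injective _ (position_injective (T := T) (n := n))
  Fintype.ofFinite _

/-- The root vectors span `𝔲`, with coordinates `e_α^*`. -/
theorem sum_dualVec_smul_rootVec (x : nilAlg k T n) :
    ∑ α, dualVec k α x • rootVec k α = x := by
  suffices h : ∀ (y : Matrix (MIdx T n) (MIdx T n) k) (hy : y ∈ nilAlg k T n),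
      ∑ α, dualVec k α ⟨y, hy⟩ • rootMatrix k α = y by
    apply Subtype.ext
    conv_rhs => rw [← h x x.2]
    simp [rootVec]
  intro y hy
  have hy' : y ∈ Submodule.span k (Set.range (rootMatrix k : PosRoot T n → _)) := hy
  change ∑ α : PosRoot T n, y α.row (MIdx.pos α.col) • rootMatrix k α = y
  clear hy
  induction hy' using Submodule.span_induction with
  | mem y hy =>
    obtain ⟨β, rfl⟩ := hy
    simp [rootMatrix_apply]
  | zero => simp
  | add y z _ _ hy hz =>
    conv_rhs => rw [← hy, ← hz]
    simp [add_smul, Finset.sum_add_distrib]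
  | smul c y _ hy =>
    conv_rhs => rw [← hy]
    simp [Finset.smul_sum, mul_smul]

/-- The root `γ` is one of the two roots occurring in a generator of `𝔭₀`. -/
def InTwin (D : Finset (PosRoot T n)) (γ : PosRoot T n) : Prop :=
  ∃ (j l r : Fin n), IsTwin D j l r ∧ ∃ hlr : l < r, γ = sub l r hlr ∨ γ = add l r hlr

/-- Two different roots of `D` in the same column are `ε_j - ε_r` and `ε_j + ε_r`. -/
theorem eq_or_pair_of_col_eq (hD : IsOrthogonalSet D) {β β' : PosRoot T n} (hβ : β ∈ D)
    (hβ' : β' ∈ D) (hc : β.col = β'.col) (hne : β ≠ β') :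
    ∃ (j r : Fin n) (h : j < r), (β = sub j r h ∧ β' = add j r h) ∨
      (β = add j r h ∧ β' = sub j r h) := by
  have key := hD β hβ β' hβ' hne
  rcases β with ⟨i, j, hij⟩ | ⟨i, j, hij⟩ | i | i <;>
  rcases β' with ⟨p, q, hpq⟩ | ⟨p, q, hpq⟩ | p | p <;>
  simp only [col] at hc <;> subst hc <;>
  simp only [vec, add_dotProduct, sub_dotProduct, single_dotProduct, Pi.add_apply,
      Pi.sub_apply, Pi.single_apply] at key <;>
  grind

theorem canonicalForm_lie_eq_sum (y x : nilAlg k T n) :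
    canonicalForm D ξ ⁅y, x⁆ =
      ∑ α, dualVec k α x * canonicalForm D ξ ⁅y, rootVec k α⁆ := by
  conv_lhs => rw [← sum_dualVec_smul_rootVec x]
  simp [lie_sum]

/-- Let `β = δ + γ` with `β ∈ D` in column `j` and `δ ∈ P`. If the coefficients `c` vanish on `M_t`
for `t < j`, twins excepted, then a root `α` contributes to `f([e_δ, ∑ c_α e_α])` only if it is the
complement in `S⁻(β')` of `δ ∈ S⁺(β')` for some `β' ∈ D`. -/
theorem splits_of_coeff_ne_zero (hk : (2 : k) ≠ 0 ∨ n ≤ 1) (hred : IsReducedSet D)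
    (hD : IsOrthogonalSet D) {c : PosRoot T n → k} {j : Fin n}
    (ih : ∀ t < j, ∀ α ∈ mCol D t, ¬ InTwin D α → c α = 0) {β δ γ : PosRoot T n} (hβ : β ∈ D)
    (hs : Splits β δ γ) (hj : β.col = j) (hδ : δ ∈ pSet D) {α : PosRoot T n} (hc : c α ≠ 0)
    (hα : canonicalForm D ξ ⁅rootVec k δ, rootVec k α⁆ ≠ 0) : ∃ β' ∈ D, Splits β' δ α := by
  obtain ⟨β', hβ', h | h⟩ := exists_of_canonicalForm_lie_ne_zero hk hα
  · exact ⟨β', hβ', h⟩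
  exfalso
  have hlt := hs.col_lt_of_mem hD h hβ hβ'
  obtain ⟨l, hl, hαl⟩ := h.exists_mem_mCol hβ' hδ
  have hz : InTwin D α := by
    by_contra hz
    exact hc (ih l (by omega) α hαl hz)
  obtain ⟨j', l', r, hz, hlr, hzz⟩ := hz
  rcases hz.splits hred hD hlr hδ hzz (Or.inr h) with ⟨i, hi, rfl⟩ | h1
  · rcases hzz with rfl | rfl <;> cases β' <;> simp only [Splits] at h <;> omega
  · exact h1.1 hβ'

/-- The relation between the coefficients at `ε_l - ε_r` and `ε_l + ε_r` given by
`f([e_{ε_j - ε_l}, x]) = 0`. -/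
theorem coeff_pair (hk : (2 : k) ≠ 0 ∨ n ≤ 1) (hred : IsReducedSet D)
    (hD : IsOrthogonalSet D) {x : nilAlg k T n}
    (hx : ∀ z ∈ pSpace D ξ, canonicalForm D ξ ⁅z, x⁆ = 0) {j : Fin n}
    (ih : ∀ t < j, ∀ α ∈ mCol D t, ¬ InTwin D α → dualVec k α x = 0) {l r : Fin n} (hjr : j < r)
    (hlr : l < r) (hs : HasSub D j r) (ha : HasAdd D j r) (h1 : HasSub (mCol D j) l r) :
    ξ (sub j r hjr) * dualVec k (sub l r hlr) x + ξ (add j r hjr) * dualVec k (add l r hlr) x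
      = 0 := by
  have hT := ne_C_of_pair hred hs ha
  obtain ⟨L₁, L₂, U₁, U₂, U₃⟩ := linked_facts hD
  rw [hasSub_mCol_iff hT] at h1
  have hjl := h1.1
  have hsp : Splits (sub j r hjr : PosRoot T n) (sub j l hjl) (sub l r hlr) := by simp [Splits]
  have hδ : (sub j l hjl : PosRoot T n) ∈ pSet D := by
    refine hsp.left_mem_pSet hD hs.2 fun p hp h => ?_
    rcases h1.2.2.2 with h' | h'
    · exact h'.2 p hp ⟨_, h⟩
    · exact hlr.ne (U₁ _ _ _ (L₂ _ _ h'.1) (L₂ _ _ ha))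
  have h0 := hx _ (rootVec_mem_pSpace hδ)
  rw [canonicalForm_lie_eq_sum, Finset.sum_eq_add (sub l r hlr) (add l r hlr) (by simp)] at h0
  · rw [lie_rootVec_sub_sub hjl hlr, lie_rootVec_sub_add hT hjl hlr] at h0
    simp only [map_neg, canonicalForm_rootVec, if_pos hs.2, if_pos ha.2] at h0
    linear_combination -h0
  · intro α _ hα
    by_contra hne
    obtain ⟨β', hβ', h⟩ := splits_of_coeff_ne_zero hk hred hD ih hs.2 hsp rfl hδ
      (left_ne_zero_of_mul hne) (right_ne_zero_of_mul hne)
    rcases β' with ⟨a, b, hab⟩ | ⟨a, b, hab⟩ | a | a <;>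
    rcases α with ⟨p, q, hpq⟩ | ⟨p, q, hpq⟩ | p | p <;> simp only [Splits] at h
    · have h2 := L₁ _ _ ⟨_, hβ'⟩
      have h3 := L₁ _ _ hs
      grind
    · have h2 := L₂ _ _ ⟨_, hβ'⟩
      have h3 := L₁ _ _ hs
      grind
    · exact hT rfl
    · exact (Linked.not_hasShort hD (L₁ _ _ hs) ⟨_, hβ', rfl⟩).1 h.1
  · simp
  · simp

/-- If `ε_t + ε_l ∈ D`, the generator of `𝔭₀` for `(j, t, r)` gives a second relation between the
coefficients at `ε_l - ε_r` and `ε_l + ε_r`. The two relations are independent in characteristic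
different from `2`. -/
theorem coeff_eq_zero_of_twin (hk : (2 : k) ≠ 0 ∨ n ≤ 1) (hred : IsReducedSet D)
    (hD : IsOrthogonalSet D) (hξ : ∀ β ∈ D, ξ β ≠ 0) {x : nilAlg k T n}
    (hx : ∀ z ∈ pSpace D ξ, canonicalForm D ξ ⁅z, x⁆ = 0) {j t l r : Fin n}
    (hjr : j < r) (htl : t < l) (hlr : l < r) (hz : IsTwin D j t r) (hD' : HasAdd D t l)
    (hrel : ξ (sub j r hjr) * dualVec k (sub l r hlr) x +
      ξ (add j r hjr) * dualVec k (add l r hlr) x = 0) :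
    dualVec k (sub l r hlr) x = 0 ∧ dualVec k (add l r hlr) x = 0 := by
  have hT := hz.ne_C hred
  obtain ⟨L₁, L₂, U₁, U₂, U₃⟩ := linked_facts hD
  have hjt := hz.lt_left hT
  have htr := htl.trans hlr
  have h0 := hx _ (hz.twinVec_mem hred hjt htr)
  have hjr' := L₁ _ _ hz.sub_mem
  have htl' := L₂ _ _ hD'
  have hshort : ∀ p, HasShort D p → p ≠ j ∧ p ≠ r ∧ p ≠ t ∧ p ≠ l := fun p hp =>
    ⟨(Linked.not_hasShort hD hjr' hp).1.symm, (Linked.not_hasShort hD hjr' hp).2.symm,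
      (Linked.not_hasShort hD htl' hp).1.symm, (Linked.not_hasShort hD htl' hp).2.symm⟩
  have hne_sub : ∀ α : PosRoot T n, α ≠ sub j t hjt → α ≠ add l r hlr →
      canonicalForm D ξ ⁅rootVec k (sub t r htr : PosRoot T n), rootVec k α⁆ = 0 := by
    intro α h1 h2
    by_contra hne
    obtain ⟨β', hβ', h⟩ := exists_of_canonicalForm_lie_ne_zero hk hne
    rcases β' with ⟨a, b, hab⟩ | ⟨a, b, hab⟩ | a | a <;>
    rcases α with ⟨p, q, hpq⟩ | ⟨p, q, hpq⟩ | p | p <;>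
    simp only [Splits, or_false, false_or] at h
    · have h3 := L₁ _ _ ⟨_, hβ'⟩
      grind
    · have h3 := L₂ _ _ ⟨_, hβ'⟩
      grind
    · exact hT rfl
    · have h3 := hshort _ ⟨_, hβ', rfl⟩
      grind
    · exact hT rfl
  have hne_add : ∀ α : PosRoot T n, α ≠ sub j t hjt → α ≠ sub l r hlr →
      canonicalForm D ξ ⁅rootVec k (add t r htr : PosRoot T n), rootVec k α⁆ = 0 := by
    intro α h1 h2
    by_contra hne
    obtain ⟨β', hβ', h⟩ := exists_of_canonicalForm_lie_ne_zero hk hne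
    rcases β' with ⟨a, b, hab⟩ | ⟨a, b, hab⟩ | a | a <;>
    rcases α with ⟨p, q, hpq⟩ | ⟨p, q, hpq⟩ | p | p <;>
    simp only [Splits, or_false] at h
    · have h3 := L₂ _ _ ⟨_, hβ'⟩
      grind
    · exact hT rfl
  have htw : canonicalForm D ξ ⁅twinVec ξ hjt htr, rootVec k (sub j t hjt : PosRoot T n)⁆ = 0 := by
    rw [← lie_skew, lie_sub_twinVec hT hjt hjt htr]
    simp only [map_neg, map_sub, map_smul, canonicalForm_rootVec, if_pos hz.sub_mem.2,
      if_pos hz.add_mem.2, smul_eq_mul]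
    ring
  rw [canonicalForm_lie_eq_sum, Finset.sum_eq_add (sub l r hlr) (add l r hlr) (by simp)] at h0
  · have e1 : canonicalForm D ξ ⁅twinVec ξ hjt htr, rootVec k (sub l r hlr : PosRoot T n)⁆ =
        - (ξ (sub j r hjr) * ξ (add t l htl)) := by
      rw [twinVec, sub_lie, smul_lie, smul_lie, lie_rootVec_add_sub_right hT htr hlr htl, map_sub,
        map_smul, map_smul, hne_sub _ (by simp only [ne_eq, sub.injEq]; omega) (by simp),
        canonicalForm_rootVec, if_pos hD'.2]
      simp
    have e2 : canonicalForm D ξ ⁅twinVec ξ hjt htr, rootVec k (add l r hlr : PosRoot T n)⁆ =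
        ξ (add j r hjr) * ξ (add t l htl) := by
      rw [twinVec, sub_lie, smul_lie, smul_lie, lie_rootVec_sub_add_right hT htr hlr htl, map_sub,
        map_smul, map_smul, hne_add _ (by simp) (by simp), canonicalForm_rootVec, if_pos hD'.2]
      simp
    rw [e1, e2] at h0
    have h2 : (2 : k) ≠ 0 := hk.resolve_right (by omega)
    have n1 := hξ _ hz.sub_mem.2
    have n2 := hξ _ hz.add_mem.2
    have n3 := hξ _ hD'.2
    constructor
    · have h3 : (2 * ξ (sub j r hjr) * ξ (add t l htl)) * dualVec k (sub l r hlr) x = 0 := by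
        linear_combination ξ (add t l htl) * hrel - h0
      exact (mul_eq_zero.1 h3).resolve_left (by simp [h2, n1, n3])
    · have h3 : (2 * ξ (add j r hjr) * ξ (add t l htl)) * dualVec k (add l r hlr) x = 0 := by
        linear_combination ξ (add t l htl) * hrel + h0
      exact (mul_eq_zero.1 h3).resolve_left (by simp [h2, n2, n3])
  · intro α _ hα
    by_cases h1 : α = sub j t hjt
    · rw [h1, htw, mul_zero]
    · rw [twinVec, sub_lie, smul_lie, smul_lie, map_sub, map_smul, map_smul, hne_sub α h1 hα.2,
        hne_add α h1 hα.1]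
      simp
  · simp
  · simp

/-- If `f([𝔭, x]) = 0`, the coefficients of `x` on `M` vanish, except at the roots of twins. -/
theorem coeff_eq_zero (hk : (2 : k) ≠ 0 ∨ n ≤ 1) (hred : IsReducedSet D)
    (hD : IsOrthogonalSet D) (hξ : ∀ β ∈ D, ξ β ≠ 0) {x : nilAlg k T n}
    (hx : ∀ z ∈ pSpace D ξ, canonicalForm D ξ ⁅z, x⁆ = 0) (j : Fin n) :
    ∀ γ ∈ mCol D j, ¬ InTwin D γ → dualVec k γ x = 0 := by
  induction j using WellFoundedLT.induction with
  | ind j ih =>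
  intro γ hγ hnt
  obtain ⟨β, hβ, δ, hs, hj, hl⟩ := mem_mCol_iff.1 hγ
  have hδ : δ ∈ pSet D := hs.left_mem_pSet hD hβ fun p hp => (hl p (hj ▸ hp)).2
  by_cases hsp : ∃ l r, HasSub D j r ∧ HasAdd D j r ∧ HasSub (mCol D j) l r ∧
      HasAdd (mCol D j) l r ∧ ∃ hlr : l < r, γ = sub l r hlr ∨ γ = add l r hlr
  · obtain ⟨l, r, h1, h2, h3, h4, hlr, hγ'⟩ := hsp
    have hT := ne_C_of_pair hred h1 h2
    have h5 : ∃ t, HasAdd D t l := by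
      by_contra! h5
      exact hnt ⟨j, l, r, ⟨h1, h2, h3, h4, h5⟩, hlr, hγ'⟩
    obtain ⟨t, ht⟩ := h5
    have hz := isTwin_of_add_mem hT hD h1 h2 h3 ht
    have := coeff_eq_zero_of_twin hk hred hD hξ hx h1.lt ht.lt hlr hz ht
      (coeff_pair hk hred hD hx ih h1.lt hlr h1 h2 h3)
    rcases hγ' with rfl | rfl
    · exact this.1
    · exact this.2
  · have h0 := hx _ (rootVec_mem_pSpace hδ)
    rw [canonicalForm_lie_eq_sum, Finset.sum_eq_single γ] at h0
    · exact (mul_eq_zero.1 h0).resolve_right (canonicalForm_lie_ne_zero hk hξ hs hβ)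
    · intro α _ hα
      by_contra hne
      have hc := left_ne_zero_of_mul hne
      obtain ⟨β', hβ', h⟩ := splits_of_coeff_ne_zero hk hred hD ih hβ hs hj hδ hc
        (right_ne_zero_of_mul hne)
      have hββ : β ≠ β' := by
        rintro rfl
        exact hα (h.right_unique hs)
      obtain ⟨i, r, hir, hcase⟩ := eq_or_pair_of_col_eq hD hβ hβ'
        (hs.col_left.symm.trans h.col_left) hββ
      have hi : i = j := by
        rcases hcase with ⟨rfl, rfl⟩ | ⟨rfl, rfl⟩
        · exact hj
        · exact hj
      subst hi
      have h1 : HasSub D i r ∧ HasAdd D i r := by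
        rcases hcase with ⟨rfl, rfl⟩ | ⟨rfl, rfl⟩
        · exact ⟨⟨_, hβ⟩, ⟨_, hβ'⟩⟩
        · exact ⟨⟨_, hβ'⟩, ⟨_, hβ⟩⟩
      have hT := ne_C_of_pair hred h1.1 h1.2
      have h2 : ∃ (l : Fin n) (hlr : l < r), (γ = sub l r hlr ∧ α = add l r hlr) ∨
          (γ = add l r hlr ∧ α = sub l r hlr) := by
        have key : ∀ {γ α : PosRoot T n}, Splits (sub i r hir) δ γ → Splits (add i r hir) δ α →
            ∃ (l : Fin n) (hlr : l < r), γ = sub l r hlr ∧ α = add l r hlr := by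
          intro γ α h h'
          rcases δ with ⟨a, b, hab⟩ | ⟨a, b, hab⟩ | a | a <;>
          rcases γ with ⟨p, q, hpq⟩ | ⟨p, q, hpq⟩ | p | p <;> simp only [Splits] at h
          obtain ⟨rfl, rfl, rfl⟩ := h
          rcases α with ⟨p', q', hpq'⟩ | ⟨p', q', hpq'⟩ | p' | p' <;> simp only [Splits] at h'
          · obtain ⟨-, ⟨rfl, rfl⟩ | ⟨rfl, rfl⟩⟩ := h'
            · exact ⟨_, hpq, rfl, rfl⟩
            · omega
          · exact absurd rfl hT
        rcases hcase with ⟨rfl, rfl⟩ | ⟨rfl, rfl⟩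
        · obtain ⟨l, hlr, h2⟩ := key hs h
          exact ⟨l, hlr, Or.inl h2⟩
        · obtain ⟨l, hlr, h2⟩ := key h hs
          exact ⟨l, hlr, Or.inr h2.symm⟩
      obtain ⟨l, hlr, h2⟩ := h2
      have hnt' : ¬ InTwin D α := by
        rintro ⟨j', l', r', hz, hlr', h3⟩
        refine hnt ⟨j', l', r', hz, hlr', ?_⟩
        rcases h2 with ⟨rfl, rfl⟩ | ⟨rfl, rfl⟩ <;> simpa using h3
      have hαm : α ∈ mCol D i := mem_mCol_iff.2 ⟨β', hβ', δ, h, by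
        rw [← h.col_left, hs.col_left, hj], fun p hp =>
          ⟨fun hm => hc (ih p hp α hm hnt'), (hl p hp).2⟩⟩
      refine hsp ⟨l, r, h1.1, h1.2, ?_⟩
      rcases h2 with ⟨rfl, rfl⟩ | ⟨rfl, rfl⟩
      · exact ⟨⟨_, hγ⟩, ⟨_, hαm⟩, _, Or.inl rfl⟩
      · exact ⟨⟨_, hαm⟩, ⟨_, hγ⟩, _, Or.inr rfl⟩
    · simp

/-- The involution exchanging `ε_i - ε_j` and `ε_i + ε_j`. -/
def flip : {T : ClassicalType} → PosRoot T n → PosRoot T n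
  | _, sub i j h => add i j h
  | _, add i j h => sub i j h
  | _, short i => short i
  | _, long i => long i

theorem flip_flip (α : PosRoot T n) : α.flip.flip = α := by
  cases α <;> rfl

theorem InTwin.flip {α : PosRoot T n} (h : InTwin D α) : InTwin D α.flip := by
  obtain ⟨j, l, r, hz, hlr, h⟩ := h
  refine ⟨j, l, r, hz, hlr, ?_⟩
  rcases h with rfl | rfl
  · exact Or.inr rfl
  · exact Or.inl rfl

/-- The orthogonal space of `𝔭` for the form `(x, y) ↦ f([x, y])` is contained in `𝔭`. -/
theorem mem_pSpace_of_forall (hk : (2 : k) ≠ 0 ∨ n ≤ 1) (hred : IsReducedSet D)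
    (hD : IsOrthogonalSet D) (hξ : ∀ β ∈ D, ξ β ≠ 0) {x : nilAlg k T n}
    (hx : ∀ z ∈ pSpace D ξ, canonicalForm D ξ ⁅z, x⁆ = 0) : x ∈ pSpace D ξ := by
  have h0 := coeff_eq_zero hk hred hD hξ hx
  have hout : ∀ α, ¬ InTwin D α → dualVec k α x • rootVec k α ∈ pSpace D ξ := by
    intro α hα
    by_cases hp : α ∈ pSet D
    · exact Submodule.smul_mem _ _ (rootVec_mem_pSpace hp)
    · simp only [mem_pSet_iff, not_forall, not_not] at hp
      obtain ⟨j, hj⟩ := hp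
      rw [h0 j α hj hα, zero_smul]
      exact Submodule.zero_mem _
  have hin : ∀ (j l r : Fin n) (hlr : l < r), IsTwin D j l r →
      dualVec k (sub l r hlr) x • rootVec k (sub l r hlr : PosRoot T n) +
        dualVec k (add l r hlr) x • rootVec k (add l r hlr : PosRoot T n) ∈ pSpace D ξ := by
    intro j l r hlr hz
    have hjl := hz.lt_left (hz.ne_C hred)
    have h1 := coeff_pair hk hred hD hx (fun t _ => h0 t) (hjl.trans hlr) hlr hz.sub_mem hz.add_mem
      hz.sub_mem_mCol
    have hne := hξ _ hz.add_mem.2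
    convert Submodule.smul_mem _ (dualVec k (sub l r hlr) x / ξ (add j r (hjl.trans hlr)))
      (hz.twinVec_mem (ξ := ξ) hred hjl hlr) using 1
    have h2 : dualVec k (add l r hlr) x = - (dualVec k (sub l r hlr) x /
        ξ (add j r (hjl.trans hlr)) * ξ (sub j r (hjl.trans hlr))) := by
      field_simp
      linear_combination h1
    rw [twinVec, smul_sub, smul_smul, smul_smul, div_mul_cancel₀ _ hne, h2, neg_smul,
      sub_eq_add_neg]
  rw [← sum_dualVec_smul_rootVec x, ← Submodule.Quotient.mk_eq_zero,
    ← Submodule.mkQ_apply, map_sum]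
  -- Modulo `𝔭` the terms outside the twins vanish, and the two terms of a twin cancel.
  refine Finset.sum_involution (fun α _ => α.flip) (fun α _ => ?_) (fun α _ hα => ?_)
    (fun _ _ => Finset.mem_univ _) fun α _ => flip_flip α
  · by_cases hα : InTwin D α
    · rw [← map_add, Submodule.mkQ_apply, Submodule.Quotient.mk_eq_zero]
      obtain ⟨j, l, r, hz, hlr, h⟩ := hα
      rcases h with rfl | rfl
      · exact hin j l r hlr hz
      · rw [add_comm]
        exact hin j l r hlr hz
    · rw [← map_add, Submodule.mkQ_apply, Submodule.Quotient.mk_eq_zero]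
      exact Submodule.add_mem _ (hout _ hα) (hout _ fun h => hα (flip_flip α ▸ h.flip))
  · have h1 : InTwin D α := by
      by_contra h
      exact hα ((Submodule.Quotient.mk_eq_zero _).2 (hout α h))
    obtain ⟨j, l, r, -, hlr, rfl | rfl⟩ := h1 <;> simp [PosRoot.flip]

end Polarization

end PosRoot

theorem theorem1p1 (k : Type*) [Field k] (T : ClassicalType) (n : ℕ)
    (hk : (2 : k) ≠ 0 ∨ n ≤ 1)
    (D : Finset (PosRoot T n)) (hD : PosRoot.IsOrthogonalSet D) (hred : PosRoot.IsReducedSet D)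
    (ξ : PosRoot T n → k) (hξ : ∀ β ∈ D, ξ β ≠ 0) :
    ∃ a : LieSubalgebra k (PosRoot.nilAlg k T n),
      a.toSubmodule = PosRoot.pSpace D ξ ∧
      IsPolarizationAt (PosRoot.canonicalForm D ξ) a := by
  refine ⟨{ PosRoot.pSpace D ξ with
    lie_mem' := fun hx hy => (PosRoot.lie_mem_pSpace_inf_ker hk hred hD hx hy).1 }, rfl, ?_, ?_⟩
  · exact fun x hx y hy => (PosRoot.lie_mem_pSpace_inf_ker hk hred hD hx hy).2
  · intro W hW hle x hx
    exact PosRoot.mem_pSpace_of_forall hk hred hD hξ fun z hz => hW z (hle hz) x hx
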